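/- Let $k$ be a field of characteristic $0$ and let $A=(a_{ij})$ be an integer $d\times n$ matrix with columns $a_1,\dots,a_n$ such that - $A$ is unimodular: for every $b$ in the lattice spanned by the columns of $A$, all vertices of $\{x\in\mathbb{R}^n : Ax=b,\ x\ge 0\}$ are integral; - the columns of $A$ span the lattice $\mathbb{Z}^d$ (in particular $\operatorname{rank} A=d$); - $\ker(A)\cap\mathbb{R}^n_{\ge 0}=\{0\}$. For $\sigma\subseteq\{1,\dots,n\}$ write $\operatorname{cone}(\sigma)$ for the set of nonnegative real combinations of the $a_j$, $j\in\sigma$. A triangulation of $A$ is a set $T$ of subsets of $\{1,\dots,n\}$, closed under taking subsets, such that $(a_j)_{j\in\sigma}$ is linearly independent for each $\sigma\in T$, $\bigcup_{\sigma\in T}\operatorname{cone}(\sigma)=\operatorname{cone}(\{1,\dots,n\})$, and $\operatorname{cone}(\sigma)\cap\operatorname{cone}(\tau)=\operatorname{cone}(\sigma\cap\tau)$ for all $\sigma,\tau\in T$. The chamber complex of $A$ is the common refinement of all triangulations of $A$, that is, the set of all cones $\bigcap_T \operatorname{cone}(\sigma_T)$, where $T$ runs over all triangulations of $A$ and $\sigma_T\in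 T$ for each $T$. Let $J_A\subset S=k[x_1,\dots,x_n]$ be the ideal generated by the binomials $x_1^{a_{i1}}\cdots x_n^{a_{in}}-1$, $i=1,\dots,d$ (if $A$ has negative entries: the contraction to $S$ of the ideal they generate in $k[x_1^{\pm1},\dots,x_n^{\pm1}]$). For $w\in\mathbb{R}^n$ let $in_w(J_A)$ be the ideal of $S$ generated by the $w$-initial forms (sums of the terms of maximal $w$-weight) of the binomials in $J_A$. The Gröbner fan of $J_A$ is the set of the closures of the classes $\{w'\in\mathbb{R}^n : in_{w'}(J_A)=in_w(J_A)\}$, where $w$ runs over the Gröbner region, i.e. over all $w\in\mathbb{R}^n$ such that $in_w(J_A)=in_v(J_A)$ for some $v\in\mathbb{R}^n_{\ge 0}$. Then: 1. For all $w,w'\in\mathbb{R}^n_{\ge 0}$, $in_w(J_A)=in_{w'}(J_A)$ if and only if $Aw$ and $Aw'$ lie in the relative interior of a common cell of the chamber complex of $A$. 2. For all $w,w'\in\mathbb{R}^n$, $in_w(J_A)=in_{w'}(J_A)$ if and only if, for every $\sigma$ such that $(a_j)_{j\in\sigma}$ is linearly independent, $Aw\in\operatorname{cone}(\sigma)\iff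 Aw'\in\operatorname{cone}(\sigma)$. 3. The Gröbner fan of $J_A$ equals the chamber complex of $A$, pulled back along $w\mapsto Aw$: it is the set of all $\{w\in\mathbb{R}^n : Aw\in C\}$, where $C$ runs over the cells of the chamber complex. -/

import Mathlib

open MvPolynomial

/-- The polyhedron `{x ∈ ℝⁿ : A x = b, x ≥ 0}`. -/
def fiberPolyhedron {d n : ℕ} (A : Matrix (Fin d) (Fin n) ℤ) (b : Fin d → ℤ) :
    Set (Fin n → ℝ) :=
  {x | (A.map (Int.cast : ℤ → ℝ)).mulVec x = (fun i => (b i : ℝ)) ∧ 0 ≤ x}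

/-- `A` is unimodular: for all `b` in the lattice spanned by the columns of `A`, every vertex of
`{x : A x = b, x ≥ 0}` is integral. -/
def IsUnimodular {d n : ℕ} (A : Matrix (Fin d) (Fin n) ℤ) : Prop :=
  ∀ b ∈ Submodule.span ℤ (Set.range A.col),
    ∀ x ∈ (fiberPolyhedron A b).extremePoints ℝ, ∀ j, ∃ z : ℤ, x j = z

/-- The `j`-th column of `A`, as a real vector. -/
def realCol {d n : ℕ} (A : Matrix (Fin d) (Fin n) ℤ) (j : Fin n) : Fin d → ℝ :=
  fun i => (A i j : ℝ)

/-- The cone of nonnegative real combinations of the columns of `A` indexed by `σ`. -/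
def colCone {d n : ℕ} (A : Matrix (Fin d) (Fin n) ℤ) (σ : Finset (Fin n)) : Set (Fin d → ℝ) :=
  (PointedCone.hull ℝ (realCol A '' (σ : Set (Fin n))) : PointedCone ℝ (Fin d → ℝ))

/-- A triangulation of (the column configuration of) `A`: a simplicial complex of index sets
of linearly independent columns, whose cones cover `cone(A)` and meet in common faces. -/
structure IsTriangulation {d n : ℕ} (A : Matrix (Fin d) (Fin n) ℤ)
    (T : Finset (Finset (Fin n))) : Prop where
  indep : ∀ σ ∈ T, LinearIndependent ℝ (fun j : σ => realCol A j)
  down_closed : ∀ σ ∈ T, ∀ τ ⊆ σ, τ ∈ T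
  cover : (⋃ σ ∈ T, colCone A σ) = colCone A Finset.univ
  inter : ∀ σ ∈ T, ∀ τ ∈ T, colCone A σ ∩ colCone A τ = colCone A (σ ∩ τ)

/-- The chamber complex of `A`: the common refinement of all triangulations of `A`. Its (closed)
cells are the intersections `⋂_T cone(σ_T)`, where `σ_T` is a cell of `T`, for each
triangulation `T` of `A`. -/
def chamberComplex {d n : ℕ} (A : Matrix (Fin d) (Fin n) ℤ) : Set (Set (Fin d → ℝ)) :=
  {C | ∃ f : Finset (Finset (Fin n)) → Finset (Fin n),
    (∀ T, IsTriangulation A T → f T ∈ T) ∧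
    C = ⋂ (T : Finset (Finset (Fin n))) (_ : IsTriangulation A T), colCone A (f T)}

/-- The inclusion of `k[x₁, …, xₙ]` into the Laurent polynomial ring
`k[x₁^±1, …, xₙ^±1]`, the group algebra of `ℤⁿ`. -/
noncomputable def toLaurent (k : Type*) [Field k] (n : ℕ) :
    MvPolynomial (Fin n) k →ₐ[k] AddMonoidAlgebra k (Fin n → ℤ) :=
  aeval (fun j => AddMonoidAlgebra.single (Pi.single j 1) 1)

/-- The ideal `J_A` of `k[x₁, …, xₙ]` generated by the binomials
`x₁^{a_{i1}} ⋯ xₙ^{a_{in}} - 1`, one for each row of `A`. The entries of `A` may be negative, so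
the ideal is generated in the Laurent polynomial ring and then contracted to the polynomial ring.
`rowIdeal_eq_span` shows that the contraction changes nothing when all entries are nonnegative
and no column vanishes. -/
noncomputable def rowIdeal (k : Type*) [Field k] {d n : ℕ} (A : Matrix (Fin d) (Fin n) ℤ) :
    Ideal (MvPolynomial (Fin n) k) :=
  Ideal.comap (toLaurent k n)
    (Ideal.span (Set.range fun i =>
      (AddMonoidAlgebra.single (A i) 1 - 1 : AddMonoidAlgebra k (Fin n → ℤ))))

/-- When `A` has nonnegative entries and no zero column, `J_A` is the ideal of `k[x₁, …, xₙ]`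
generated by the polynomials `∏ⱼ xⱼ ^ a_{ij} - 1`. -/
theorem rowIdeal_eq_span (k : Type*) [Field k] {d n : ℕ} (A : Matrix (Fin d) (Fin n) ℤ)
    (h0 : ∀ i j, 0 ≤ A i j) (h1 : ∀ j, ∃ i, A i j ≠ 0) :
    rowIdeal k A = Ideal.span (Set.range fun i =>
      (∏ j, (X j : MvPolynomial (Fin n) k) ^ (A i j).toNat - 1)) := by
  have himg : ∀ i, toLaurent k n (∏ j, (X j : MvPolynomial (Fin n) k) ^ (A i j).toNat - 1) =
      AddMonoidAlgebra.single (A i) 1 - 1 := by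
    intro i
    have hs : (∑ j, (A i j).toNat • (Pi.single j 1 : Fin n → ℤ)) = A i := by
      ext l
      simp [Finset.sum_apply, Pi.single_apply, h0]
    have : ∀ s : Finset (Fin n), (∏ j ∈ s, (AddMonoidAlgebra.single (Pi.single j 1) 1 :
        AddMonoidAlgebra k (Fin n → ℤ)) ^ (A i j).toNat) =
        AddMonoidAlgebra.single (∑ j ∈ s, (A i j).toNat • (Pi.single j 1 : Fin n → ℤ)) 1 := by
      intro s
      induction s using Finset.induction_on with
      | empty => simp [AddMonoidAlgebra.one_def]
      | insert a s ha ih =>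
        rw [Finset.prod_insert ha, ih, Finset.sum_insert ha, AddMonoidAlgebra.single_pow,
          AddMonoidAlgebra.single_mul_single]
        simp
    simp only [toLaurent, map_sub, map_prod, map_pow, aeval_X, map_one]
    rw [this, hs]
  set I : Ideal (MvPolynomial (Fin n) k) := Ideal.span (Set.range fun i =>
      (∏ j, (X j : MvPolynomial (Fin n) k) ^ (A i j).toNat - 1)) with hI
  apply le_antisymm
  · have hrow : ∀ i, ∏ j, (Ideal.Quotient.mk I (X j)) ^ (A i j).toNat = 1 := by
      intro i
      have : Ideal.Quotient.mk I (∏ j, (X j : MvPolynomial (Fin n) k) ^ (A i j).toNat - 1) = 0 :=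
        Ideal.Quotient.eq_zero_iff_mem.2 (Ideal.subset_span ⟨i, rfl⟩)
      simpa [sub_eq_zero] using this
    have hu : ∀ j, IsUnit (Ideal.Quotient.mk I (X j)) := by
      intro j
      obtain ⟨i, hi⟩ := h1 j
      have hd : (Ideal.Quotient.mk I (X j)) ^ (A i j).toNat ∣ 1 := by
        rw [← hrow i]
        exact Finset.dvd_prod_of_mem _ (Finset.mem_univ j)
      have hp : (A i j).toNat ≠ 0 := by
        have := h0 i j
        omega
      exact (isUnit_pow_iff hp).1 (isUnit_of_dvd_one hd)
    choose u hu using hu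
    let φ : Multiplicative (Fin n → ℤ) →* (MvPolynomial (Fin n) k ⧸ I) :=
      { toFun := fun v => ((∏ j, u j ^ (Multiplicative.toAdd v j) : _ˣ) : _ ⧸ I)
        map_one' := by simp
        map_mul' := fun v w => by
          simp only [toAdd_mul, Pi.add_apply, zpow_add, Finset.prod_mul_distrib, Units.val_mul] }
    let ψ : AddMonoidAlgebra k (Fin n → ℤ) →ₐ[k] (MvPolynomial (Fin n) k ⧸ I) :=
      AddMonoidAlgebra.lift k _ _ φ
    have hψ : ψ.comp (toLaurent k n) = Ideal.Quotient.mkₐ k I := by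
      apply MvPolynomial.algHom_ext
      intro j
      have : (∏ l, u l ^ ((Pi.single j 1 : Fin n → ℤ) l)) = u j := by
        rw [Finset.prod_eq_single j] <;> simp +contextual
      have h2 : φ (Multiplicative.ofAdd (Pi.single j 1)) = Ideal.Quotient.mk I (X j) := by
        rw [← hu j]
        exact congrArg Units.val this
      simp [ψ, toLaurent, h2, AddMonoidAlgebra.lift_single]
    intro f hf
    have hf' : toLaurent k n f ∈ RingHom.ker ψ := by
      refine (Ideal.span_le.2 ?_ : Ideal.span _ ≤ RingHom.ker ψ) hf
      rintro _ ⟨i, rfl⟩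
      show ψ (AddMonoidAlgebra.single (A i) 1 - 1) = 0
      rw [← himg i]
      have := DFunLike.congr_fun hψ (∏ j, (X j : MvPolynomial (Fin n) k) ^ (A i j).toNat - 1)
      rw [AlgHom.comp_apply] at this
      rw [this]
      exact Ideal.Quotient.eq_zero_iff_mem.2 (Ideal.subset_span ⟨i, rfl⟩)
    have := DFunLike.congr_fun hψ f
    rw [AlgHom.comp_apply] at this
    exact Ideal.Quotient.eq_zero_iff_mem.1 (this.symm.trans hf')
  · rw [hI, Ideal.span_le]
    rintro _ ⟨i, rfl⟩
    show toLaurent k n (∏ j, (X j : MvPolynomial (Fin n) k) ^ (A i j).toNat - 1) ∈ Ideal.span _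
    rw [himg i]
    exact Ideal.subset_span ⟨i, rfl⟩

open Classical in
/-- The `w`-initial form of `f`: the sum of all terms of `f` of maximal `w`-weight. -/
noncomputable def initialForm {k : Type*} [Field k] {n : ℕ} (w : Fin n → ℝ)
    (f : MvPolynomial (Fin n) k) : MvPolynomial (Fin n) k :=
  ∑ a ∈ f.support with ∀ b ∈ f.support, Finsupp.weight w b ≤ Finsupp.weight w a,
    monomial a (f.coeff a)

/-- A binomial: a polynomial with exactly two terms. -/
def IsBinomial {k : Type*} [Field k] {n : ℕ} (f : MvPolynomial (Fin n) k) : Prop :=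
  f.support.card = 2

/-- The initial ideal `in_w(J)` of a binomial ideal `J`: the ideal generated by the `w`-initial
forms of the binomials in `J`. -/
noncomputable def initialIdeal {k : Type*} [Field k] {n : ℕ} (J : Ideal (MvPolynomial (Fin n) k))
    (w : Fin n → ℝ) : Ideal (MvPolynomial (Fin n) k) :=
  Ideal.span (initialForm w '' {f | f ∈ J ∧ IsBinomial f})

/-- The Gröbner region: all weight vectors whose initial ideal is also the initial ideal for a
nonnegative weight vector. -/
def groebnerRegion {k : Type*} [Field k] {n : ℕ} (J : Ideal (MvPolynomial (Fin n) k)) :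
    Set (Fin n → ℝ) :=
  {w | ∃ w' : Fin n → ℝ, 0 ≤ w' ∧ initialIdeal J w' = initialIdeal J w}

/-- The Gröbner fan of a binomial ideal `J`: the closures of the classes of weight vectors in the
Gröbner region with the same initial ideal. -/
def groebnerFan {k : Type*} [Field k] {n : ℕ} (J : Ideal (MvPolynomial (Fin n) k)) :
    Set (Set (Fin n → ℝ)) :=
  {C | ∃ w ∈ groebnerRegion J, C = closure {w' | initialIdeal J w' = initialIdeal J w}}

/-!
The three assertions follow from a comparison of two equivalence relations on points `b = A w`.

*Initial ideals.* The binomials in `J_A` are the multiples of `x^u - x^v` with `v - u` in the row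
lattice of `A` (`exists_eq_monomial_sub_of_isBinomial`), and along `v = u + yᵀA` the weight changes
by `y ⬝ b`. Hence a monomial `x^u` lies outside `in_w(J_A)` exactly when `u` minimizes the weight on
its fiber (`IsFiberMin`, `monomial_mem_initialIdeal_iff`), and these monomials determine the whole
initial ideal (`initialIdeal_eq_iff`). By integer programming duality, `u` is a minimizer if and
only if `b` lies in the cone of the columns `a_j` with `u j = 0` (`isFiberMin_iff_mem_colCone`).
This is where unimodularity enters: if `b` is outside that cone, a vertex of the polytope of
separating vectors `y` with `|y ⬝ a_j| ≤ 1` is integral, so it gives a descent step within the fiber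
(`exists_int_separating`). By Carathéodory's theorem, `in_w(J_A)` and `in_w'(J_A)` therefore agree
if and only if `A w` and `A w'` lie in the same cones over independent columns (`SameCones`).

*Chambers.* Every independent set of columns is a cell of some regular triangulation, with heights
zero on this set and generic positive heights elsewhere (`exists_isTriangulation_mem`). Hence the
cells of the chamber complex are the sets `chamber A b` for `b` in the cone of `A`, where
`chamber A b` is the intersection of all cones over independent columns that contain `b`
(`chamberComplex_eq_image_chamber`). In each triangulation a point has a unique carrier, and
comparing carriers shows that the relative interior of `chamber A b` is the class of `b` under
`SameCones` (`sameCones_iff_exists_mem_chamberComplex`), and that the closure of the pullback of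
this class is the pullback of `chamber A b` (`closure_sameCones_preimage`).
-/

/-! ### Finitely generated cones and relative interiors -/

section FiniteCones

variable {ι E : Type*} [Fintype ι] [NormedAddCommGroup E] [NormedSpace ℝ E]

/-- The cone of nonnegative combinations of the vectors `v j`, `j ∈ σ`, with the coefficients
recorded as a function on all of `ι` that vanishes outside `σ`. -/
def finCone (v : ι → E) (σ : Finset ι) : Set E :=
  {b | ∃ x : ι → ℝ, (∀ j, 0 ≤ x j) ∧ (∀ j ∉ σ, x j = 0) ∧ ∑ j, x j • v j = b}

/-- The set of combinations of the `v j`, `j ∈ σ`, with strictly positive coefficients; for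
independent `v j` this is the relative interior of the cone they span. -/
def openCone (v : ι → E) (σ : Finset ι) : Set E :=
  {b | ∃ x : ι → ℝ, (∀ j ∈ σ, 0 < x j) ∧ (∀ j ∉ σ, x j = 0) ∧ ∑ j, x j • v j = b}

theorem linearIndependent_finset_iff (v : ι → E) (σ : Finset ι) :
    LinearIndependent ℝ (fun j : σ => v j) ↔
      ∀ g : ι → ℝ, (∀ j ∉ σ, g j = 0) → ∑ j, g j • v j = 0 → g = 0 := by
  classical
  have key : ∀ g : ι → ℝ, (∀ j ∉ σ, g j = 0) → ∑ j : σ, g j • v j = ∑ j, g j • v j := by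
    intro g hg
    rw [Finset.sum_coe_sort σ (fun j => g j • v j)]
    exact Finset.sum_subset (Finset.subset_univ _) (fun j _ hj => by simp [hg j hj])
  rw [Fintype.linearIndependent_iff]
  constructor
  · intro h g hg hs
    funext j
    by_cases hj : j ∈ σ
    · exact h (fun j => g j) (by rw [key g hg, hs]) ⟨j, hj⟩
    · exact hg j hj
  · intro h g hg i
    let g' : ι → ℝ := fun j => if hj : j ∈ σ then g ⟨j, hj⟩ else 0
    have h0 : ∀ j ∉ σ, g' j = 0 := fun j hj => by simp [g', hj]
    have h1 := h g' h0 (by rw [← key g' h0, ← hg]; exact Finset.sum_congr rfl (by simp [g']))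
    simpa [g'] using congrFun h1 i

theorem openCone_subset_finCone (v : ι → E) (σ : Finset ι) : openCone v σ ⊆ finCone v σ := by
  rintro b ⟨x, hx, h0, hb⟩
  refine ⟨x, fun j => ?_, h0, hb⟩
  by_cases hj : j ∈ σ
  · exact (hx j hj).le
  · exact (h0 j hj).ge

theorem finCone_mono (v : ι → E) {σ τ : Finset ι} (h : σ ⊆ τ) : finCone v σ ⊆ finCone v τ := by
  rintro b ⟨x, hx, h0, hb⟩
  exact ⟨x, hx, fun j hj => h0 j (fun h' => hj (h h')), hb⟩

theorem zero_mem_finCone (v : ι → E) (σ : Finset ι) : (0 : E) ∈ finCone v σ :=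
  ⟨0, by simp, by simp, by simp⟩

theorem smul_mem_finCone {v : ι → E} {σ : Finset ι} {b : E} (hb : b ∈ finCone v σ) {t : ℝ}
    (ht : 0 ≤ t) : t • b ∈ finCone v σ := by
  obtain ⟨x, hx, h0, rfl⟩ := hb
  refine ⟨t • x, fun j => mul_nonneg ht (hx j), fun j hj => by simp [h0 j hj], ?_⟩
  simp [Finset.smul_sum, smul_smul]

theorem add_mem_finCone {v : ι → E} {σ : Finset ι} {b c : E} (hb : b ∈ finCone v σ)
    (hc : c ∈ finCone v σ) : b + c ∈ finCone v σ := by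
  obtain ⟨x, hx, hx0, rfl⟩ := hb
  obtain ⟨y, hy, hy0, rfl⟩ := hc
  refine ⟨x + y, fun j => add_nonneg (hx j) (hy j), fun j hj => by simp [hx0 j hj, hy0 j hj], ?_⟩
  simp [add_smul, Finset.sum_add_distrib]

theorem mem_finCone_self (v : ι → E) {σ : Finset ι} {j : ι} (hj : j ∈ σ) : v j ∈ finCone v σ := by
  classical
  refine ⟨Pi.single j 1, fun i => ?_, fun i hi => ?_, ?_⟩
  · by_cases h : i = j
    · subst h; simp
    · simp [h]
  · have : i ≠ j := fun h => hi (h ▸ hj)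
    simp [this]
  · simp [Pi.single_apply]

theorem convex_finCone (v : ι → E) (σ : Finset ι) : Convex ℝ (finCone v σ) :=
  fun _ hb _ hc _ _ hs ht _ => add_mem_finCone (smul_mem_finCone hb hs) (smul_mem_finCone hc ht)

theorem hull_eq_finCone (v : ι → E) (σ : Finset ι) :
    (PointedCone.hull ℝ (v '' (σ : Set ι)) : Set E) = finCone v σ := by
  classical
  apply Set.Subset.antisymm
  · intro b hb
    induction hb using Submodule.span_induction with
    | mem b hb =>
      obtain ⟨j, hj, rfl⟩ := hb
      exact mem_finCone_self v hj
    | zero => exact zero_mem_finCone v σ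
    | add b c _ _ hb hc => exact add_mem_finCone hb hc
    | smul t b _ hb => exact smul_mem_finCone hb t.2
  · rintro b ⟨x, hx, h0, rfl⟩
    refine Submodule.sum_mem _ fun j _ => ?_
    by_cases hj : j ∈ σ
    · exact PointedCone.smul_mem _ (hx j) (Submodule.subset_span ⟨j, hj, rfl⟩)
    · rw [h0 j hj, zero_smul]; exact Submodule.zero_mem _

theorem exists_openCone_of_mem_finCone {v : ι → E} {σ : Finset ι} {b : E}
    (hb : b ∈ finCone v σ) : ∃ τ ⊆ σ, b ∈ openCone v τ := by
  classical
  obtain ⟨x, hx, h0, rfl⟩ := hb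
  refine ⟨σ.filter (fun j => 0 < x j), Finset.filter_subset _ _, x, fun j hj => ?_, fun j hj => ?_,
    rfl⟩
  · exact (Finset.mem_filter.1 hj).2
  · by_cases hjσ : j ∈ σ
    · by_contra h
      exact hj (Finset.mem_filter.2 ⟨hjσ, lt_of_le_of_ne (hx j) (Ne.symm h)⟩)
    · exact h0 j hjσ

/-- A positive combination of dependent vectors can be rewritten with fewer of them: subtract the
largest multiple of a linear relation that keeps all coefficients nonnegative. -/
theorem exists_ssubset_of_not_linearIndependent {v : ι → E} {σ : Finset ι} {b : E}
    (hb : b ∈ openCone v σ) (hσ : ¬ LinearIndependent ℝ (fun j : σ => v j)) :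
    ∃ τ ⊂ σ, b ∈ finCone v τ := by
  classical
  obtain ⟨x, hx, h0, rfl⟩ := hb
  rw [linearIndependent_finset_iff] at hσ
  push Not at hσ
  obtain ⟨g, hg0, hgs, hgne⟩ := hσ
  obtain ⟨g, hg0, hgs, i, hi⟩ : ∃ g : ι → ℝ, (∀ j ∉ σ, g j = 0) ∧ ∑ j, g j • v j = 0 ∧
      ∃ i, 0 < g i := by
    obtain ⟨i, hi⟩ := Function.ne_iff.1 hgne
    rcases lt_or_gt_of_ne hi with h | h
    · exact ⟨-g, fun j hj => by simp [hg0 j hj], by simp [hgs], i, by simpa using h⟩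
    · exact ⟨g, hg0, hgs, i, h⟩
  obtain ⟨l, hl, hmin⟩ := Finset.exists_min_image (Finset.univ.filter (fun j => 0 < g j))
    (fun j => x j / g j) ⟨i, by simpa using hi⟩
  have hgl : 0 < g l := by simpa using hl
  have hlσ : l ∈ σ := by
    by_contra h
    rw [hg0 l h] at hgl
    exact lt_irrefl _ hgl
  set t := x l / g l with ht
  have htpos : 0 < t := div_pos (hx l hlσ) hgl
  have hxnn : ∀ j, 0 ≤ x j := fun j => by
    by_cases hj : j ∈ σ
    · exact (hx j hj).le
    · exact (h0 j hj).ge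
  refine ⟨σ.erase l, Finset.erase_ssubset hlσ, fun j => x j - t * g j, fun j => ?_,
    fun j hj => ?_, ?_⟩
  · by_cases hj : 0 < g j
    · have := hmin j (by simpa using hj)
      rw [le_div_iff₀ hj] at this
      linarith
    · have := mul_nonneg htpos.le (neg_nonneg.2 (not_lt.1 hj))
      have := hxnn j
      linarith
  · by_cases hjl : j = l
    · subst hjl
      rw [ht]; field_simp; ring
    · have : j ∉ σ := fun h => hj (Finset.mem_erase.2 ⟨hjl, h⟩)
      simp [h0 j this, hg0 j this]
  · simp only [sub_smul, Finset.sum_sub_distrib, mul_smul]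
    rw [← Finset.smul_sum, hgs]; simp

/-- Carathéodory's theorem for finitely generated cones. -/
theorem exists_linearIndependent_of_mem_finCone {v : ι → E} {σ : Finset ι} {b : E}
    (hb : b ∈ finCone v σ) :
    ∃ τ ⊆ σ, LinearIndependent ℝ (fun j : τ => v j) ∧ b ∈ finCone v τ := by
  induction σ using Finset.strongInduction with
  | H σ ih =>
    obtain ⟨τ, hτ, hbτ⟩ := exists_openCone_of_mem_finCone hb
    by_cases hind : LinearIndependent ℝ (fun j : τ => v j)
    · exact ⟨τ, hτ, hind, openCone_subset_finCone v τ hbτ⟩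
    · obtain ⟨ρ, hρ, hbρ⟩ := exists_ssubset_of_not_linearIndependent hbτ hind
      obtain ⟨κ, hκ, h1, h2⟩ := ih ρ (lt_of_lt_of_le hρ hτ) hbρ
      exact ⟨κ, hκ.trans (hρ.subset.trans hτ), h1, h2⟩

theorem isClosed_finCone_of_linearIndependent {v : ι → E} {σ : Finset ι}
    (h : LinearIndependent ℝ (fun j : σ => v j)) : IsClosed (finCone v σ) := by
  classical
  let f : (σ → ℝ) →ₗ[ℝ] E := Fintype.linearCombination ℝ (fun j : σ => v j)
  have hf : LinearMap.ker f = ⊥ :=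
    LinearMap.ker_eq_bot.2 (LinearIndependent.fintypeLinearCombination_injective h)
  have hce := LinearMap.isClosedEmbedding_of_injective hf
  have : finCone v σ = f '' {x | ∀ j, 0 ≤ x j} := by
    apply Set.Subset.antisymm
    · rintro b ⟨x, hx, h0, rfl⟩
      refine ⟨fun j => x j, fun j => hx j, ?_⟩
      simp only [f, Fintype.linearCombination_apply]
      rw [Finset.sum_coe_sort σ (fun j => x j • v j)]
      exact Finset.sum_subset (Finset.subset_univ _) (fun j _ hj => by simp [h0 j hj])
    · rintro _ ⟨x, hx, rfl⟩
      simp only [f, Fintype.linearCombination_apply]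
      have : ∀ s : Finset σ, ∑ j ∈ s, x j • v j ∈ finCone v σ := by
        intro s
        induction s using Finset.induction_on with
        | empty => simpa using zero_mem_finCone v σ
        | insert a s ha ih =>
          rw [Finset.sum_insert ha]
          exact add_mem_finCone (smul_mem_finCone (mem_finCone_self v a.2) (hx a)) ih
      exact this _
  rw [this]
  refine hce.isClosedMap _ ?_
  simp only [Set.ofPred_forall]
  exact isClosed_iInter fun j => isClosed_le continuous_const (continuous_apply j)

theorem isClosed_finCone (v : ι → E) (σ : Finset ι) : IsClosed (finCone v σ) := by
  classical
  have : finCone v σ =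
      ⋃ τ ∈ {τ : Finset ι | τ ⊆ σ ∧ LinearIndependent ℝ (fun j : τ => v j)}, finCone v τ := by
    ext b
    simp only [Set.mem_iUnion, Set.mem_ofPred_eq, exists_prop]
    constructor
    · intro hb
      obtain ⟨τ, h1, h2, h3⟩ := exists_linearIndependent_of_mem_finCone hb
      exact ⟨τ, ⟨h1, h2⟩, h3⟩
    · rintro ⟨τ, ⟨h1, -⟩, h3⟩
      exact finCone_mono v h1 h3
  rw [this]
  exact (Set.toFinite _).isClosed_biUnion fun τ hτ => isClosed_finCone_of_linearIndependent hτ.2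

/-- Farkas' lemma: a vector outside a finitely generated cone is separated from it. -/
theorem exists_separating_of_notMem_finCone {v : ι → E} {σ : Finset ι} {b : E}
    (hb : b ∉ finCone v σ) : ∃ f : E →L[ℝ] ℝ, (∀ j ∈ σ, 0 ≤ f (v j)) ∧ f b < 0 := by
  obtain ⟨f, u, hfu, hub⟩ :=
    geometric_hahn_banach_closed_point (convex_finCone v σ) (isClosed_finCone v σ) hb
  have hu : 0 < u := by simpa using hfu 0 (zero_mem_finCone v σ)
  refine ⟨-f, fun j hj => ?_, by simpa using hu.trans hub⟩
  by_contra h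
  have h1 : 0 < f (v j) := by simpa using h
  have := hfu _ (smul_mem_finCone (mem_finCone_self v hj) (div_nonneg hu.le h1.le))
  rw [map_smul, smul_eq_mul, div_mul_cancel₀ _ h1.ne'] at this
  exact lt_irrefl _ this

theorem combo_mem_openCone {v : ι → E} {σ : Finset ι} {b p : E} (hb : b ∈ openCone v σ)
    (hp : p ∈ finCone v σ) {s t : ℝ} (hs : 0 < s) (ht : 0 ≤ t) : s • b + t • p ∈ openCone v σ := by
  obtain ⟨x, hx, hx0, rfl⟩ := hb
  obtain ⟨z, hz, hz0, rfl⟩ := hp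
  refine ⟨s • x + t • z, fun j hj => ?_, fun j hj => by simp [hx0 j hj, hz0 j hj], ?_⟩
  · have := mul_pos hs (hx j hj)
    have := mul_nonneg ht (hz j)
    simp only [Pi.add_apply, Pi.smul_apply, smul_eq_mul]
    linarith
  · simp [add_smul, Finset.sum_add_distrib, Finset.smul_sum, smul_smul]

theorem eventually_add_smul_sub_mem_finCone {v : ι → E} {σ : Finset ι} {b p : E}
    (hb : b ∈ openCone v σ) (hp : p ∈ finCone v σ) :
    ∀ᶠ ε in nhds (0 : ℝ), b + ε • (b - p) ∈ finCone v σ := by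
  obtain ⟨x, hx, hx0, rfl⟩ := hb
  obtain ⟨z, hz, hz0, rfl⟩ := hp
  have : ∀ᶠ ε in nhds (0 : ℝ), ∀ j ∈ σ, 0 < x j + ε * (x j - z j) := by
    rw [Filter.eventually_all_finset]
    intro j hj
    have hc : Continuous fun ε : ℝ => x j + ε * (x j - z j) := by fun_prop
    exact hc.continuousAt.eventually (lt_mem_nhds (by simpa using hx j hj))
  filter_upwards [this] with ε hε
  refine openCone_subset_finCone v σ ⟨fun j => x j + ε * (x j - z j), hε,
    fun j hj => by simp [hx0 j hj, hz0 j hj], ?_⟩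
  simp only [add_smul, mul_smul, sub_smul, Finset.sum_add_distrib, Finset.sum_sub_distrib,
    ← Finset.smul_sum]

end FiniteCones

section RelativeInterior

variable {E : Type*} [NormedAddCommGroup E] [NormedSpace ℝ E]

theorem mem_intrinsicInterior_iff_exists_dist {C : Set E} {b : E} :
    b ∈ intrinsicInterior ℝ C ↔
      b ∈ affineSpan ℝ C ∧ ∃ r > 0, ∀ z ∈ affineSpan ℝ C, dist z b < r → z ∈ C := by
  rw [mem_intrinsicInterior]
  constructor
  · rintro ⟨y, hy, rfl⟩
    obtain ⟨r, hr, h⟩ := Metric.mem_nhds_iff.1 (mem_interior_iff_mem_nhds.1 hy)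
    exact ⟨y.2, r, hr, fun z hz hd => @h ⟨z, hz⟩ hd⟩
  · rintro ⟨hb, r, hr, h⟩
    refine ⟨⟨b, hb⟩, mem_interior_iff_mem_nhds.2 (Metric.mem_nhds_iff.2 ⟨r, hr, ?_⟩), rfl⟩
    rintro ⟨z, hz⟩ hd
    exact h z hz hd

/-- From a relative interior point one can move a little away from any point of the set. -/
theorem exists_add_smul_sub_mem_of_mem_intrinsicInterior {C : Set E} {b p : E}
    (hb : b ∈ intrinsicInterior ℝ C) (hp : p ∈ C) : ∃ ε > (0 : ℝ), b + ε • (b - p) ∈ C := by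
  obtain ⟨hbs, r, hr, h⟩ := mem_intrinsicInterior_iff_exists_dist.1 hb
  refine ⟨r / (‖b - p‖ + 1), by positivity, h _ ?_ ?_⟩
  · have := AffineSubspace.vadd_mem_of_mem_direction (s := affineSpan ℝ C)
      (Submodule.smul_mem _ (r / (‖b - p‖ + 1))
        (AffineSubspace.vsub_mem_direction hbs (subset_affineSpan ℝ C hp))) hbs
    simpa [add_comm] using this
  · rw [dist_eq_norm, add_sub_cancel_left, norm_smul, Real.norm_of_nonneg (by positivity),
      div_mul_eq_mul_div, div_lt_iff₀ (by positivity)]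
    nlinarith [norm_nonneg (b - p)]

/-- The open segment from a relative interior point of a convex set to any of its points stays in
the relative interior. -/
theorem combo_mem_intrinsicInterior {C : Set E} (hC : Convex ℝ C) {c q : E}
    (hc : c ∈ intrinsicInterior ℝ C) (hq : q ∈ C) {s t : ℝ} (hs : 0 < s) (ht : 0 ≤ t)
    (hst : s + t = 1) : s • c + t • q ∈ intrinsicInterior ℝ C := by
  obtain ⟨hcs, r, hr, h⟩ := mem_intrinsicInterior_iff_exists_dist.1 hc
  have hcC := intrinsicInterior_subset hc
  have hmem : s • c + t • q ∈ affineSpan ℝ C :=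
    subset_affineSpan ℝ C (hC hcC hq hs.le ht hst)
  refine mem_intrinsicInterior_iff_exists_dist.2 ⟨hmem, s * r, by positivity, fun z hz hd => ?_⟩
  have h1 : c + s⁻¹ • (z - (s • c + t • q)) ∈ C := by
    apply h
    · have := AffineSubspace.vadd_mem_of_mem_direction (s := affineSpan ℝ C)
        (Submodule.smul_mem _ s⁻¹ (AffineSubspace.vsub_mem_direction hz hmem)) hcs
      simpa [add_comm] using this
    · rw [dist_eq_norm, add_sub_cancel_left, norm_smul, Real.norm_of_nonneg (by positivity),
        ← dist_eq_norm, inv_mul_lt_iff₀ hs]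
      exact hd
  have h2 := hC h1 hq hs.le ht hst
  rwa [smul_add, smul_smul, mul_inv_cancel₀ hs.ne', one_smul,
    show s • c + (z - (s • c + t • q)) + t • q = z by abel] at h2

end RelativeInterior

/-! ### Regular triangulations -/

section Lifting

variable {ι E : Type*} [Fintype ι] [NormedAddCommGroup E] [NormedSpace ℝ E]

/-- Linear programming duality, with complementary slackness: a point `b` of the cone lies in the
cone of those `v j` at which some functional dominated by the heights `ω` attains its bound. An
optimal functional comes from Farkas' lemma in `E × ℝ`, for the lifted vectors `(v j, ω j)`. -/
theorem exists_functional_le_mem_finCone (v : ι → E) {ω : ι → ℝ} (hω : ∀ j, 0 ≤ ω j) {b : E}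
    (hb : b ∈ finCone v Finset.univ) :
    ∃ y : E →L[ℝ] ℝ, (∀ j, y (v j) ≤ ω j) ∧ ∃ x : ι → ℝ, (∀ j, 0 ≤ x j) ∧
      (∀ j, y (v j) ≠ ω j → x j = 0) ∧ ∑ j, x j • v j = b := by
  classical
  let u : ι → E × ℝ := fun j => (v j, ω j)
  let S : Set ℝ := {s | (b, s) ∈ finCone u Finset.univ}
  have hmem : ∀ s, s ∈ S ↔ ∃ x : ι → ℝ, (∀ j, 0 ≤ x j) ∧ ∑ j, x j • v j = b ∧
      ∑ j, x j * ω j = s := by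
    intro s
    constructor
    · rintro ⟨x, hx, -, h⟩
      refine ⟨x, hx, ?_, ?_⟩
      · simpa [u, Prod.fst_sum] using congrArg Prod.fst h
      · simpa [u, Prod.snd_sum] using congrArg Prod.snd h
    · rintro ⟨x, hx, h1, h2⟩
      exact ⟨x, hx, by simp, Prod.ext (by simpa [u, Prod.fst_sum] using h1)
        (by simpa [u, Prod.snd_sum] using h2)⟩
  have hSclosed : IsClosed S :=
    (isClosed_finCone u Finset.univ).preimage (by fun_prop : Continuous fun s : ℝ => (b, s))
  have hSne : S.Nonempty := by
    obtain ⟨x, hx, -, h⟩ := hb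
    exact ⟨_, (hmem _).2 ⟨x, hx, h, rfl⟩⟩
  have hSbdd : BddBelow S := by
    refine ⟨0, fun s hs => ?_⟩
    obtain ⟨x, hx, -, rfl⟩ := (hmem s).1 hs
    exact Finset.sum_nonneg fun j _ => mul_nonneg (hx j) (hω j)
  obtain ⟨m, hmS, hmin⟩ : ∃ m ∈ S, ∀ s ∈ S, m ≤ s :=
    ⟨sInf S, hSclosed.csInf_mem hSne hSbdd, fun s hs => csInf_le hSbdd hs⟩
  let u' : Option (Option ι) → E × ℝ := fun o =>
    match o with
    | none => (0, 1)
    | some none => (-b, -m)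
    | some (some j) => u j
  have hnot : ((0, -1) : E × ℝ) ∉ finCone u' Finset.univ := by
    rintro ⟨x, hx, -, h⟩
    rw [Fintype.sum_option, Fintype.sum_option] at h
    have h1 := congrArg Prod.fst h
    have h2 := congrArg Prod.snd h
    simp only [u', u, Prod.fst_add, Prod.snd_add, Prod.smul_mk, Prod.fst_sum, Prod.snd_sum,
      smul_zero, zero_add, smul_eq_mul, smul_neg] at h1 h2
    have h1' : ∑ j, x (some (some j)) • v j = x (some none) • b := by
      rw [← sub_eq_zero, sub_eq_add_neg, add_comm]; exact h1
    have hx1 := hx none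
    rcases (hx (some none)).eq_or_lt with h0 | h0
    · have := Finset.sum_nonneg (s := Finset.univ) fun (j : ι) _ =>
        mul_nonneg (hx (some (some j))) (hω j)
      rw [← h0] at h2
      linarith
    · have := hmin ((x (some none))⁻¹ * ∑ j, x (some (some j)) * ω j) ((hmem _).2
        ⟨fun j => (x (some none))⁻¹ * x (some (some j)),
          fun j => mul_nonneg (inv_nonneg.2 h0.le) (hx _), ?_, ?_⟩)
      · rw [le_inv_mul_iff₀ h0] at this
        linarith
      · simp only [mul_smul]
        rw [← Finset.smul_sum, h1', smul_smul, inv_mul_cancel₀ h0.ne', one_smul]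
      · rw [Finset.mul_sum]
        exact Finset.sum_congr rfl fun j _ => by ring
  obtain ⟨f, hf, hneg⟩ := exists_separating_of_notMem_finCone hnot
  set s := f (0, 1) with hs
  have hspos : 0 < s := by
    have : f (0, -1) = -s := by rw [hs, ← map_neg]; simp
    linarith
  have hsplit : ∀ (e : E) (r : ℝ), f (e, r) = f (e, 0) + r * s := by
    intro e r
    rw [hs, ← smul_eq_mul, ← map_smul, ← map_add]; simp
  let y : E →L[ℝ] ℝ := -(s⁻¹ • f.comp (ContinuousLinearMap.inl ℝ E ℝ))
  have hy : ∀ e, f (e, 0) = - (s * y e) := by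
    intro e
    simp [y, mul_inv_cancel_left₀ hspos.ne']
  have hyle : ∀ j, y (v j) ≤ ω j := by
    intro j
    have h := hf (some (some j)) (Finset.mem_univ _)
    simp only [u', u] at h
    rw [hsplit, hy] at h
    have : s * y (v j) ≤ s * ω j := by linarith
    exact le_of_mul_le_mul_left this hspos
  have hym : m ≤ y b := by
    have h := hf (some none) (Finset.mem_univ _)
    simp only [u'] at h
    rw [hsplit, hy, map_neg] at h
    have : s * m ≤ s * y b := by linarith
    exact le_of_mul_le_mul_left this hspos
  obtain ⟨x, hx, hxb, hxm⟩ := (hmem m).1 hmS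
  refine ⟨y, hyle, x, hx, fun j hj => ?_, hxb⟩
  have hyb : y b = ∑ j, x j * y (v j) := by rw [← hxb]; simp
  have hsum : ∑ j, x j * (ω j - y (v j)) ≤ 0 := by
    simp only [mul_sub, Finset.sum_sub_distrib]
    rw [hxm, ← hyb]; linarith
  have hz := (Finset.sum_eq_zero_iff_of_nonneg (fun j _ =>
    mul_nonneg (hx j) (sub_nonneg.2 (hyle j)))).1 (le_antisymm hsum (Finset.sum_nonneg fun j _ =>
      mul_nonneg (hx j) (sub_nonneg.2 (hyle j)))) j (Finset.mem_univ j)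
  rcases mul_eq_zero.1 hz with h | h
  · exact h
  · exact absurd (sub_eq_zero.1 h).symm hj

/-- Generic heights vanishing exactly on an independent set `σ`: no linear relation among the
vectors carries over to the heights. The heights are powers of a parameter avoiding the roots of
finitely many polynomials. -/
theorem exists_generic_heights {n : ℕ} (v : Fin n → E) {σ : Finset (Fin n)}
    (hσ : LinearIndependent ℝ (fun j : σ => v j)) :
    ∃ ω : Fin n → ℝ, (∀ j, 0 ≤ ω j) ∧ (∀ j ∈ σ, ω j = 0) ∧
      ∀ τ : Finset (Fin n), ¬ LinearIndependent ℝ (fun j : τ => v j) →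
        ∃ c : Fin n → ℝ, (∀ j ∉ τ, c j = 0) ∧ ∑ j, c j • v j = 0 ∧ ∑ j, c j * ω j ≠ 0 := by
  classical
  have hrel : ∀ τ : Finset (Fin n), ∃ c : Fin n → ℝ,
      ¬ LinearIndependent ℝ (fun j : τ => v j) →
        (∀ j ∉ τ, c j = 0) ∧ ∑ j, c j • v j = 0 ∧ c ≠ 0 := by
    intro τ
    by_cases h : LinearIndependent ℝ (fun j : τ => v j)
    · exact ⟨0, fun h' => absurd h h'⟩
    · have h' := h
      rw [linearIndependent_finset_iff] at h'
      push Not at h'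
      obtain ⟨c, h1, h2, h3⟩ := h'
      exact ⟨c, fun _ => ⟨h1, h2, h3⟩⟩
  choose c hc using hrel
  let p : Finset (Fin n) → Polynomial ℝ := fun τ =>
    ∑ j ∈ σᶜ, Polynomial.monomial ((j : ℕ) + 1) (c τ j)
  have hp : ∀ τ : Finset (Fin n), ¬ LinearIndependent ℝ (fun j : τ => v j) → p τ ≠ 0 := by
    intro τ hτ h0
    obtain ⟨-, h2, h3⟩ := hc τ hτ
    refine h3 ((linearIndependent_finset_iff v σ).1 hσ (c τ) (fun j hj => ?_) h2)
    have := congrArg (fun q => q.coeff ((j : ℕ) + 1)) h0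
    simp only [p, Polynomial.finsetSum_coeff, Polynomial.coeff_monomial, Polynomial.coeff_zero]
      at this
    rw [Finset.sum_eq_single j] at this
    · simpa using this
    · intro i _ hij
      rw [if_neg]
      intro h
      exact hij (Fin.ext (by omega))
    · intro h
      exact absurd (Finset.mem_compl.2 hj) h
  obtain ⟨t, ht, htroot⟩ := (Set.Ioi_infinite (0 : ℝ)).exists_notMem_finset
    ((Finset.univ : Finset (Finset (Fin n))).biUnion fun τ => (p τ).roots.toFinset)
  have ht : 0 < t := ht
  refine ⟨fun j => if j ∈ σ then 0 else t ^ ((j : ℕ) + 1), fun j => ?_, fun j hj => by simp [hj],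
    fun τ hτ => ⟨c τ, (hc τ hτ).1, (hc τ hτ).2.1, fun h => ?_⟩⟩
  · dsimp only
    split_ifs
    · exact le_rfl
    · positivity
  · refine htroot (Finset.mem_biUnion.2 ⟨τ, Finset.mem_univ _, ?_⟩)
    rw [Multiset.mem_toFinset, Polynomial.mem_roots (hp τ hτ), Polynomial.IsRoot.def]
    rw [← h]
    simp only [p, Polynomial.eval_finsetSum, Polynomial.eval_monomial]
    refine Finset.sum_subset_zero_on_sdiff (Finset.subset_univ _) (fun j hj => ?_) (fun j hj => ?_)
    · have : j ∈ σ := by simpa using hj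
      simp [this]
    · have : j ∉ σ := by simpa using hj
      simp [this]

end Lifting

section Triangulations

variable {d n : ℕ}

theorem colCone_eq_finCone (A : Matrix (Fin d) (Fin n) ℤ) (σ : Finset (Fin n)) :
    colCone A σ = finCone (realCol A) σ :=
  hull_eq_finCone (realCol A) σ

open Classical in
/-- The regular subdivision of `A` induced by the heights `ω`: its cells are the sets of columns at
which some linear functional dominated by `ω` attains its bound. -/
noncomputable def regularSubdivision (A : Matrix (Fin d) (Fin n) ℤ) (ω : Fin n → ℝ) :
    Finset (Finset (Fin n)) :=
  Finset.univ.filter fun τ => ∃ y : (Fin d → ℝ) →L[ℝ] ℝ,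
    (∀ j, y (realCol A j) ≤ ω j) ∧ ∀ j ∈ τ, y (realCol A j) = ω j

/-- Every independent set of columns is a cell of a triangulation, namely of a regular one whose
heights vanish exactly on this set. -/
theorem exists_isTriangulation_mem (A : Matrix (Fin d) (Fin n) ℤ) {σ : Finset (Fin n)}
    (hσ : LinearIndependent ℝ (fun j : σ => realCol A j)) :
    ∃ T, IsTriangulation A T ∧ σ ∈ T := by
  classical
  obtain ⟨ω, hω, hωσ, hgen⟩ := exists_generic_heights (realCol A) hσ
  have hmem : ∀ τ, τ ∈ regularSubdivision A ω ↔ ∃ y : (Fin d → ℝ) →L[ℝ] ℝ,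
      (∀ j, y (realCol A j) ≤ ω j) ∧ ∀ j ∈ τ, y (realCol A j) = ω j := by
    intro τ; simp [regularSubdivision]
  have hind : ∀ τ ∈ regularSubdivision A ω, LinearIndependent ℝ (fun j : τ => realCol A j) := by
    intro τ hτ
    obtain ⟨y, -, hy⟩ := (hmem τ).1 hτ
    by_contra h
    obtain ⟨c, hc0, hcs, hne⟩ := hgen τ h
    apply hne
    have : y (∑ j, c j • realCol A j) = 0 := by rw [hcs, map_zero]
    rw [← this, map_sum]
    refine Finset.sum_congr rfl fun j _ => ?_
    by_cases hj : j ∈ τ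
    · rw [map_smul, hy j hj, smul_eq_mul]
    · simp [hc0 j hj]
  refine ⟨regularSubdivision A ω, ⟨hind, ?_, ?_, ?_⟩, ?_⟩
  · intro τ hτ ρ hρ
    obtain ⟨y, h1, h2⟩ := (hmem τ).1 hτ
    exact (hmem ρ).2 ⟨y, h1, fun j hj => h2 j (hρ hj)⟩
  · apply Set.Subset.antisymm
    · simp only [Set.iUnion_subset_iff, colCone_eq_finCone]
      exact fun τ _ => finCone_mono _ (Finset.subset_univ τ)
    · intro b hb
      rw [colCone_eq_finCone] at hb
      obtain ⟨y, hy, x, hx, hx0, hxb⟩ := exists_functional_le_mem_finCone (realCol A) hω hb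
      refine Set.mem_biUnion
        ((hmem (Finset.univ.filter fun j => y (realCol A j) = ω j)).2 ⟨y, hy, by simp⟩) ?_
      rw [colCone_eq_finCone]
      exact ⟨x, hx, fun j hj => hx0 j (by simpa using hj), hxb⟩
  · intro τ hτ ρ hρ
    simp only [colCone_eq_finCone]
    refine Set.Subset.antisymm ?_ (Set.subset_inter (finCone_mono _ Finset.inter_subset_left)
      (finCone_mono _ Finset.inter_subset_right))
    rintro b ⟨⟨x, hx, hx0, hxb⟩, ⟨z, hz, hz0, hzb⟩⟩
    obtain ⟨y, hy, hyτ⟩ := (hmem τ).1 hτ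
    obtain ⟨y', hy', hyρ⟩ := (hmem ρ).1 hρ
    have e1 : ∀ (f : (Fin d → ℝ) →L[ℝ] ℝ) (x : Fin n → ℝ), ∑ j, x j • realCol A j = b →
        f b = ∑ j, x j * f (realCol A j) := by
      rintro f x rfl; simp
    have tight : ∀ (τ : Finset (Fin n)) (f : (Fin d → ℝ) →L[ℝ] ℝ) (x : Fin n → ℝ),
        (∀ j ∉ τ, x j = 0) → (∀ j ∈ τ, f (realCol A j) = ω j) →
        ∑ j, x j * f (realCol A j) = ∑ j, x j * ω j := by
      intro τ f x h1 h2
      refine Finset.sum_congr rfl fun j _ => ?_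
      by_cases hj : j ∈ τ
      · rw [h2 j hj]
      · simp [h1 j hj]
    have loose : ∀ (f : (Fin d → ℝ) →L[ℝ] ℝ) (x : Fin n → ℝ), (∀ j, 0 ≤ x j) →
        (∀ j, f (realCol A j) ≤ ω j) → ∑ j, x j * f (realCol A j) ≤ ∑ j, x j * ω j :=
      fun f x h1 h2 => Finset.sum_le_sum fun j _ => mul_le_mul_of_nonneg_left (h2 j) (h1 j)
    -- both representations of `b` have the same total height, so `y` is tight on the second one
    have hle : ∑ j, z j * ω j ≤ ∑ j, z j * y (realCol A j) := by
      rw [← tight ρ y' z hz0 hyρ, ← e1 y' z hzb, e1 y' x hxb, ← e1 y z hzb, e1 y x hxb,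
        tight τ y x hx0 hyτ]
      exact loose y' x hx hy'
    have htz : ∀ j, z j ≠ 0 → y (realCol A j) = ω j := by
      intro j hj
      have hnn : ∀ j ∈ Finset.univ, 0 ≤ z j * (ω j - y (realCol A j)) := fun j _ =>
        mul_nonneg (hz j) (sub_nonneg.2 (hy j))
      have hs : ∑ j, z j * (ω j - y (realCol A j)) ≤ 0 := by
        simp only [mul_sub, Finset.sum_sub_distrib]; linarith
      have := (Finset.sum_eq_zero_iff_of_nonneg hnn).1
        (le_antisymm hs (Finset.sum_nonneg hnn)) j (Finset.mem_univ j)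
      exact (sub_eq_zero.1 ((mul_eq_zero.1 this).resolve_left hj)).symm
    have hT := (linearIndependent_finset_iff _ _).1 (hind
      (Finset.univ.filter fun j => y (realCol A j) = ω j) ((hmem _).2 ⟨y, hy, by simp⟩))
    have hxz : x - z = 0 := by
      refine hT (x - z) (fun j hj => ?_) (by simp [sub_smul, Finset.sum_sub_distrib, hxb, hzb])
      have hj : y (realCol A j) ≠ ω j := by simpa using hj
      have h1 : x j = 0 := hx0 j fun h => hj (hyτ j h)
      have h2 : z j = 0 := by
        by_contra h
        exact hj (htz j h)
      simp [h1, h2]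
    have hxz : x = z := sub_eq_zero.1 hxz
    refine ⟨x, hx, fun j hj => ?_, hxb⟩
    by_cases h : j ∈ τ
    · rw [hxz]
      exact hz0 j fun h' => hj (Finset.mem_inter.2 ⟨h, h'⟩)
    · exact hx0 j h
  · refine (hmem σ).2 ⟨0, fun j => by simpa using hω j, fun j hj => by simp [hωσ j hj]⟩

/-- Each point of the cone of `A` has a carrier in a triangulation: a cell that contains it with
strictly positive coefficients. -/
theorem IsTriangulation.exists_openCone {A : Matrix (Fin d) (Fin n) ℤ}
    {T : Finset (Finset (Fin n))} (hT : IsTriangulation A T) {b : Fin d → ℝ}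
    (hb : b ∈ colCone A Finset.univ) : ∃ σ ∈ T, b ∈ openCone (realCol A) σ := by
  rw [← hT.cover] at hb
  obtain ⟨σ, hσ, hbσ⟩ := Set.mem_iUnion₂.1 hb
  rw [colCone_eq_finCone] at hbσ
  obtain ⟨τ, hτ, h⟩ := exists_openCone_of_mem_finCone hbσ
  exact ⟨τ, hT.down_closed σ hσ τ hτ, h⟩

/-- The carrier of a point is contained in every cell whose cone contains the point. -/
theorem IsTriangulation.subset_of_mem_openCone {A : Matrix (Fin d) (Fin n) ℤ}
    {T : Finset (Finset (Fin n))} (hT : IsTriangulation A T) {σ τ : Finset (Fin n)}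
    (hσ : σ ∈ T) (hτ : τ ∈ T) {b : Fin d → ℝ} (hb : b ∈ openCone (realCol A) σ)
    (hbτ : b ∈ colCone A τ) : σ ⊆ τ := by
  have h := hT.inter σ hσ τ hτ
  simp only [colCone_eq_finCone] at h hbτ
  obtain ⟨z, hz, hz0, hzb⟩ : b ∈ finCone (realCol A) (σ ∩ τ) :=
    h ▸ ⟨openCone_subset_finCone _ _ hb, hbτ⟩
  obtain ⟨x, hx, hx0, hxb⟩ := hb
  have hxz : x - z = 0 := by
    refine (linearIndependent_finset_iff _ _).1 (hT.indep σ hσ) (x - z) (fun j hj => ?_)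
      (by simp [sub_smul, Finset.sum_sub_distrib, hxb, hzb])
    simp [hx0 j hj, hz0 j fun h => hj (Finset.mem_inter.1 h).1]
  intro j hj
  by_contra hjτ
  have h1 := hx j hj
  rw [sub_eq_zero.1 hxz, hz0 j fun h => hjτ (Finset.mem_inter.1 h).2] at h1
  exact lt_irrefl _ h1

theorem IsTriangulation.mem_colCone_iff_subset {A : Matrix (Fin d) (Fin n) ℤ}
    {T : Finset (Finset (Fin n))} (hT : IsTriangulation A T) {σ τ : Finset (Fin n)}
    (hσ : σ ∈ T) (hτ : τ ∈ T) {b : Fin d → ℝ} (hb : b ∈ openCone (realCol A) σ) :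
    b ∈ colCone A τ ↔ σ ⊆ τ := by
  refine ⟨hT.subset_of_mem_openCone hσ hτ hb, fun h => ?_⟩
  rw [colCone_eq_finCone]
  exact finCone_mono _ h (openCone_subset_finCone _ _ hb)

end Triangulations

/-! ### The chamber complex -/

section Chambers

variable {d n : ℕ}

/-- Two points lie in the same cones spanned by independent columns of `A`. -/
def SameCones (A : Matrix (Fin d) (Fin n) ℤ) (b b' : Fin d → ℝ) : Prop :=
  ∀ σ : Finset (Fin n), LinearIndependent ℝ (fun j : σ => realCol A j) →
    (b ∈ colCone A σ ↔ b' ∈ colCone A σ)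

/-- The smallest intersection of cones spanned by independent columns of `A` that contains `b`. -/
def chamber (A : Matrix (Fin d) (Fin n) ℤ) (b : Fin d → ℝ) : Set (Fin d → ℝ) :=
  {p | ∀ σ : Finset (Fin n), LinearIndependent ℝ (fun j : σ => realCol A j) →
    b ∈ colCone A σ → p ∈ colCone A σ}

theorem SameCones.symm {A : Matrix (Fin d) (Fin n) ℤ} {b b' : Fin d → ℝ} (h : SameCones A b b') :
    SameCones A b' b := fun σ hσ => (h σ hσ).symm

theorem SameCones.chamber_eq {A : Matrix (Fin d) (Fin n) ℤ} {b b' : Fin d → ℝ}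
    (h : SameCones A b b') : chamber A b = chamber A b' := by
  ext p
  exact forall_congr' fun σ => forall_congr' fun hσ => by rw [h σ hσ]

/-- By Carathéodory's theorem the cones spanned by independent columns control all others. -/
theorem sameCones_iff_forall {A : Matrix (Fin d) (Fin n) ℤ} {b b' : Fin d → ℝ} :
    SameCones A b b' ↔ ∀ σ : Finset (Fin n), b ∈ colCone A σ ↔ b' ∈ colCone A σ := by
  refine ⟨fun h => ?_, fun h σ _ => h σ⟩
  have key : ∀ {b b' : Fin d → ℝ}, SameCones A b b' → ∀ σ, b ∈ colCone A σ → b' ∈ colCone A σ := by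
    intro b b' h σ hb
    rw [colCone_eq_finCone] at hb ⊢
    obtain ⟨τ, hτ, hi, hbτ⟩ := exists_linearIndependent_of_mem_finCone hb
    rw [← colCone_eq_finCone] at hbτ
    have := (h τ hi).1 hbτ
    rw [colCone_eq_finCone] at this
    exact finCone_mono _ hτ this
  exact fun σ => ⟨key h σ, key h.symm σ⟩

theorem convex_colCone (A : Matrix (Fin d) (Fin n) ℤ) (σ : Finset (Fin n)) :
    Convex ℝ (colCone A σ) :=
  colCone_eq_finCone A σ ▸ convex_finCone _ σ

theorem isClosed_colCone (A : Matrix (Fin d) (Fin n) ℤ) (σ : Finset (Fin n)) :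
    IsClosed (colCone A σ) :=
  colCone_eq_finCone A σ ▸ isClosed_finCone _ σ

theorem self_mem_chamber (A : Matrix (Fin d) (Fin n) ℤ) (b : Fin d → ℝ) : b ∈ chamber A b :=
  fun _ _ h => h

theorem convex_chamber (A : Matrix (Fin d) (Fin n) ℤ) (b : Fin d → ℝ) :
    Convex ℝ (chamber A b) :=
  fun _ hp _ hq _ _ hs ht hst σ hσ hb =>
    convex_colCone A σ (hp σ hσ hb) (hq σ hσ hb) hs ht hst

theorem isClosed_chamber (A : Matrix (Fin d) (Fin n) ℤ) (b : Fin d → ℝ) :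
    IsClosed (chamber A b) := by
  simp only [chamber, Set.ofPred_forall]
  exact isClosed_iInter fun σ => isClosed_iInter fun _ => isClosed_iInter fun _ =>
    isClosed_colCone A σ

/-- The points of the segment from `b` to a point of its chamber, the latter excluded, lie in the
same cones as `b`: in each triangulation they have the same carrier as `b`. -/
theorem sameCones_combo {A : Matrix (Fin d) (Fin n) ℤ} {b p : Fin d → ℝ}
    (hb : b ∈ colCone A Finset.univ) (hp : p ∈ chamber A b) {s t : ℝ} (hs : 0 < s) (ht : 0 ≤ t) :
    SameCones A b (s • b + t • p) := by
  intro σ hσ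
  obtain ⟨T, hT, hσT⟩ := exists_isTriangulation_mem A hσ
  obtain ⟨τ, hτT, hbτ⟩ := hT.exists_openCone hb
  have hpτ := hp τ (hT.indep τ hτT) ((hT.mem_colCone_iff_subset hτT hτT hbτ).2 subset_rfl)
  rw [colCone_eq_finCone] at hpτ
  rw [hT.mem_colCone_iff_subset hτT hσT hbτ,
    hT.mem_colCone_iff_subset hτT hσT (combo_mem_openCone hbτ hpτ hs ht)]

/-- From `b` one can move a little away from any point of its chamber. -/
theorem exists_add_smul_sub_mem_chamber {A : Matrix (Fin d) (Fin n) ℤ} {b p : Fin d → ℝ}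
    (hp : p ∈ chamber A b) : ∃ ε > (0 : ℝ), b + ε • (b - p) ∈ chamber A b := by
  have : ∀ᶠ ε in nhds (0 : ℝ), b + ε • (b - p) ∈ chamber A b := by
    refine Filter.eventually_all.2 fun σ => ?_
    by_cases hσ : LinearIndependent ℝ (fun j : σ => realCol A j)
    swap
    · exact Filter.Eventually.of_forall fun _ h => absurd h hσ
    by_cases hb : b ∈ colCone A σ
    swap
    · exact Filter.Eventually.of_forall fun _ _ h => absurd h hb
    suffices ∀ᶠ ε in nhds (0 : ℝ), b + ε • (b - p) ∈ colCone A σ by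
      filter_upwards [this] with ε hε _ _ using hε
    rw [colCone_eq_finCone] at hb ⊢
    obtain ⟨τ, hτ, hbτ⟩ := exists_openCone_of_mem_finCone hb
    have hpτ := hp τ (LinearIndependent.comp hσ (fun j : τ => (⟨j, hτ j.2⟩ : σ)) (fun i j h =>
      Subtype.ext (congrArg (fun k : σ => (k : Fin n)) h)))
      (by rw [colCone_eq_finCone]; exact openCone_subset_finCone _ _ hbτ)
    rw [colCone_eq_finCone] at hpτ
    filter_upwards [eventually_add_smul_sub_mem_finCone hbτ hpτ] with ε hε
    exact finCone_mono _ hτ hε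
  obtain ⟨ε, h1, h2⟩ := ((this.filter_mono nhdsWithin_le_nhds).and
    (self_mem_nhdsWithin : Set.Ioi (0 : ℝ) ∈ nhdsWithin 0 (Set.Ioi 0))).exists
  exact ⟨ε, h2, h1⟩

theorem self_mem_intrinsicInterior_chamber (A : Matrix (Fin d) (Fin n) ℤ) (b : Fin d → ℝ) :
    b ∈ intrinsicInterior ℝ (chamber A b) := by
  obtain ⟨c, hc⟩ := Set.Nonempty.intrinsicInterior (convex_chamber A b) ⟨b, self_mem_chamber A b⟩
  obtain ⟨ε, hε, hq⟩ := exists_add_smul_sub_mem_chamber (intrinsicInterior_subset hc)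
  -- `b` lies strictly between the relative interior point `c` and the point `b + ε • (b - c)`
  have := combo_mem_intrinsicInterior (convex_chamber A b) hc hq
    (s := ε / (1 + ε)) (t := 1 / (1 + ε)) (by positivity) (by positivity) (by field_simp; ring)
  convert this using 1
  have h1 : (1 + ε) ≠ 0 := by positivity
  ext i
  simp only [Pi.add_apply, Pi.smul_apply, Pi.sub_apply, smul_eq_mul]
  field_simp
  ring

theorem chamber_mem_chamberComplex {A : Matrix (Fin d) (Fin n) ℤ} {b : Fin d → ℝ}
    (hb : b ∈ colCone A Finset.univ) : chamber A b ∈ chamberComplex A := by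
  classical
  have : ∀ T : Finset (Finset (Fin n)), ∃ σ : Finset (Fin n), IsTriangulation A T →
      σ ∈ T ∧ b ∈ openCone (realCol A) σ := by
    intro T
    by_cases hT : IsTriangulation A T
    · obtain ⟨σ, h⟩ := hT.exists_openCone hb
      exact ⟨σ, fun _ => h⟩
    · exact ⟨∅, fun h => absurd h hT⟩
  choose f hf using this
  refine ⟨f, fun T hT => (hf T hT).1, Set.Subset.antisymm ?_ ?_⟩
  · intro p hp
    refine Set.mem_iInter₂.2 fun T hT => hp _ (hT.indep _ (hf T hT).1) ?_
    exact (hT.mem_colCone_iff_subset (hf T hT).1 (hf T hT).1 (hf T hT).2).2 subset_rfl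
  · intro p hp σ hσ hbσ
    obtain ⟨T, hT, hσT⟩ := exists_isTriangulation_mem A hσ
    have hpf := Set.mem_iInter₂.1 hp T hT
    have hsub := hT.subset_of_mem_openCone (hf T hT).1 hσT (hf T hT).2 hbσ
    rw [colCone_eq_finCone] at hpf ⊢
    exact finCone_mono _ hsub hpf

/-- A cell of the chamber complex is the chamber of each of its relative interior points: a face
of a simplicial cone containing such a point contains the whole cell. -/
theorem eq_chamber_of_mem_intrinsicInterior {A : Matrix (Fin d) (Fin n) ℤ} {C : Set (Fin d → ℝ)}
    (hC : C ∈ chamberComplex A) {b : Fin d → ℝ} (hb : b ∈ intrinsicInterior ℝ C) :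
    b ∈ colCone A Finset.univ ∧ C = chamber A b := by
  obtain ⟨f, hf, hCf⟩ := hC
  have hCsub : ∀ T, IsTriangulation A T → C ⊆ colCone A (f T) := by
    intro T hT p hp
    rw [hCf] at hp
    exact Set.mem_iInter₂.1 hp T hT
  have hbC := intrinsicInterior_subset hb
  refine ⟨?_, Set.Subset.antisymm ?_ ?_⟩
  · obtain ⟨T, hT, -⟩ := exists_isTriangulation_mem A (σ := ∅)
      ((linearIndependent_finset_iff _ _).2 fun g hg _ => funext fun j => hg j (by simp))
    have := hCsub T hT hbC
    rw [colCone_eq_finCone] at this ⊢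
    exact finCone_mono _ (Finset.subset_univ _) this
  · intro p hp σ hσ hbσ
    obtain ⟨T, hT, hσT⟩ := exists_isTriangulation_mem A hσ
    obtain ⟨ε, hε, hq⟩ := exists_add_smul_sub_mem_of_mem_intrinsicInterior hb hp
    have hbσf : b ∈ colCone A (σ ∩ f T) :=
      hT.inter σ hσT _ (hf T hT) ▸ ⟨hbσ, hCsub T hT hbC⟩
    have hpf := hCsub T hT hp
    have hqf := hCsub T hT hq
    rw [colCone_eq_finCone] at hbσf hpf hqf ⊢
    obtain ⟨x, hx, hx0, hxb⟩ := hbσf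
    obtain ⟨z, hz, hz0, hzp⟩ := hpf
    obtain ⟨y, hy, hy0, hyq⟩ := hqf
    have hfT := (linearIndependent_finset_iff _ _).1 (hT.indep _ (hf T hT))
      (x + ε • (x - z) - y) (fun j hj => by
        simp [hx0 j fun h => hj (Finset.mem_inter.1 h).2, hz0 j hj, hy0 j hj]) (by
        simp only [Pi.sub_apply, Pi.add_apply, Pi.smul_apply, smul_eq_mul, add_smul, mul_smul,
          sub_smul, Finset.sum_add_distrib, Finset.sum_sub_distrib, ← Finset.smul_sum, hxb, hzp,
          hyq, sub_self])
    refine ⟨z, hz, fun j hj => ?_, hzp⟩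
    have h1 := congrFun hfT j
    simp only [Pi.sub_apply, Pi.add_apply, Pi.smul_apply, smul_eq_mul, Pi.zero_apply,
      hx0 j fun h => hj (Finset.mem_inter.1 h).1] at h1
    have h2 := hy j
    have h3 := mul_nonneg hε.le (hz j)
    have h4 : ε * z j = 0 := by linarith
    exact (mul_eq_zero.1 h4).resolve_left hε.ne'
  · intro p hp
    rw [hCf]
    exact Set.mem_iInter₂.2 fun T hT => hp _ (hT.indep _ (hf T hT)) (hCsub T hT hbC)

theorem chamberComplex_eq_image_chamber (A : Matrix (Fin d) (Fin n) ℤ) :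
    chamberComplex A = chamber A '' colCone A Finset.univ := by
  apply Set.Subset.antisymm
  · intro C hC
    have hCconv : Convex ℝ C := by
      obtain ⟨f, -, rfl⟩ := hC
      exact convex_iInter₂ fun T _ => convex_colCone A (f T)
    have hCne : C.Nonempty := by
      obtain ⟨f, -, rfl⟩ := hC
      exact ⟨0, Set.mem_iInter₂.2 fun T _ => by
        rw [colCone_eq_finCone]; exact zero_mem_finCone _ _⟩
    obtain ⟨b, hb⟩ := Set.Nonempty.intrinsicInterior hCconv hCne
    obtain ⟨h1, h2⟩ := eq_chamber_of_mem_intrinsicInterior hC hb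
    exact ⟨b, h1, h2.symm⟩
  · rintro _ ⟨b, hb, rfl⟩
    exact chamber_mem_chamberComplex hb

theorem sameCones_iff_exists_mem_chamberComplex {A : Matrix (Fin d) (Fin n) ℤ} {b b' : Fin d → ℝ}
    (hb : b ∈ colCone A Finset.univ) :
    SameCones A b b' ↔ ∃ C ∈ chamberComplex A,
      b ∈ intrinsicInterior ℝ C ∧ b' ∈ intrinsicInterior ℝ C := by
  constructor
  · intro h
    refine ⟨chamber A b, chamber_mem_chamberComplex hb, self_mem_intrinsicInterior_chamber A b, ?_⟩
    rw [h.chamber_eq]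
    exact self_mem_intrinsicInterior_chamber A b'
  · rintro ⟨C, hC, h, h'⟩
    have hbb' : chamber A b = chamber A b' :=
      (eq_chamber_of_mem_intrinsicInterior hC h).2.symm.trans
        (eq_chamber_of_mem_intrinsicInterior hC h').2
    have h1 : b' ∈ chamber A b := hbb' ▸ self_mem_chamber A b'
    have h2 : b ∈ chamber A b' := hbb' ▸ self_mem_chamber A b
    exact fun σ hσ => ⟨h1 σ hσ, h2 σ hσ⟩

/-- The closure of the class of `w` is the pullback of its chamber: a point `p` of the latter is
the limit of the points `t • w + p` of the class as `t` decreases to `0`. -/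
theorem closure_sameCones_preimage (A : Matrix (Fin d) (Fin n) ℤ) {F : Type*}
    [NormedAddCommGroup F] [NormedSpace ℝ F] (f : F →L[ℝ] (Fin d → ℝ)) {w : F}
    (hw : f w ∈ colCone A Finset.univ) :
    closure {w' | SameCones A (f w) (f w')} = f ⁻¹' chamber A (f w) := by
  apply Set.Subset.antisymm
  · refine closure_minimal (fun w' hw' => ?_) ((isClosed_chamber A _).preimage f.continuous)
    exact fun σ hσ => (hw' σ hσ).1
  · intro p hp
    have hlim : Filter.Tendsto (fun t : ℝ => t • w + (1 : ℝ) • p) (nhdsWithin 0 (Set.Ioi 0))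
        (nhds p) := by
      have : Continuous fun t : ℝ => t • w + (1 : ℝ) • p := by fun_prop
      have h := this.tendsto 0
      simp only [zero_smul, one_smul, zero_add] at h
      simp only [one_smul]
      exact h.mono_left nhdsWithin_le_nhds
    refine mem_closure_of_tendsto hlim ?_
    filter_upwards [self_mem_nhdsWithin] with t ht
    simp only [map_add, map_smul]
    exact sameCones_combo hw hp ht zero_le_one

end Chambers

/-! ### Integer programming over unimodular matrices -/

section Unimodular

variable {d n : ℕ}

theorem mulVec_map_cast_eq_sum (A : Matrix (Fin d) (Fin n) ℤ) (x : Fin n → ℝ) :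
    (A.map (Int.cast : ℤ → ℝ)).mulVec x = ∑ j, x j • realCol A j := by
  ext i
  simp [Matrix.mulVec, dotProduct, realCol, Finset.sum_apply, mul_comm]

theorem exists_forall_eq_dotProduct (f : (Fin d → ℝ) →ₗ[ℝ] ℝ) :
    ∃ z : Fin d → ℝ, ∀ v, f v = dotProduct z v := by
  refine ⟨fun i => f (Pi.single i 1), fun v => ?_⟩
  rw [LinearMap.pi_apply_eq_sum_univ f v]
  refine Finset.sum_congr rfl fun i _ => ?_
  rw [smul_eq_mul, mul_comm]
  congr 2
  ext j
  simp [Pi.single_apply, eq_comm]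

theorem dotProduct_intCast_realCol (A : Matrix (Fin d) (Fin n) ℤ) (y : Fin d → ℤ) (j : Fin n) :
    dotProduct (fun i => (y i : ℝ)) (realCol A j) = ((Matrix.vecMul y A j : ℤ) : ℝ) := by
  simp [dotProduct, realCol, Matrix.vecMul]

theorem dotProduct_sum_smul_realCol (A : Matrix (Fin d) (Fin n) ℤ) (y : Fin d → ℝ)
    (x : Fin n → ℝ) :
    dotProduct y (∑ j, x j • realCol A j) = ∑ j, x j * dotProduct y (realCol A j) := by
  simp [dotProduct_sum]

/-- A nonnegative point of a fiber whose support is independent is a vertex of the fiber. -/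
theorem mem_extremePoints_fiberPolyhedron {A : Matrix (Fin d) (Fin n) ℤ} {b : Fin d → ℤ}
    {σ : Finset (Fin n)} (hσ : LinearIndependent ℝ (fun j : σ => realCol A j)) {x : Fin n → ℝ}
    (hx : x ∈ fiberPolyhedron A b) (hx0 : ∀ j ∉ σ, x j = 0) :
    x ∈ (fiberPolyhedron A b).extremePoints ℝ := by
  refine ⟨hx, fun x₁ hx₁ x₂ hx₂ hseg => ?_⟩
  obtain ⟨s, t, hs, ht, -, h⟩ := hseg
  have hx₁0 : ∀ j ∉ σ, x₁ j = 0 := by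
    intro j hj
    have h1 := congrFun h j
    simp only [Pi.add_apply, Pi.smul_apply, smul_eq_mul, hx0 j hj] at h1
    have h2 := mul_nonneg hs.le (hx₁.2 j)
    have h3 := mul_nonneg ht.le (hx₂.2 j)
    have h4 : s * x₁ j = 0 := by linarith
    exact (mul_eq_zero.1 h4).resolve_left hs.ne'
  have := (linearIndependent_finset_iff _ _).1 hσ (x₁ - x)
    (fun j hj => by simp [hx0 j hj, hx₁0 j hj]) (by
      rw [← mulVec_map_cast_eq_sum, Matrix.mulVec_sub, hx.1, hx₁.1, sub_self])
  exact sub_eq_zero.1 this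

/-- For a unimodular matrix the coordinate vectors are integral combinations of any spanning set
of columns, so a vector with integral pairings against such a set is integral. -/
theorem exists_eq_intCast_of_span_eq_top {A : Matrix (Fin d) (Fin n) ℤ} (hA : IsUnimodular A)
    (hspan : Submodule.span ℤ (Set.range A.col) = ⊤) {β : Set (Fin n)}
    (hβ : Submodule.span ℝ (realCol A '' β) = ⊤) {y : Fin d → ℝ}
    (hy : ∀ j ∈ β, ∃ z : ℤ, dotProduct y (realCol A j) = z) :
    ∃ y' : Fin d → ℤ, y = fun i => (y' i : ℝ) := by
  classical
  obtain ⟨τ, hτβ, -, hτspan, hτ⟩ := exists_linearIndepOn_extension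
    (linearIndepOn_empty ℝ (realCol A)) (Set.empty_subset β)
  have htop : Submodule.span ℝ (realCol A '' τ) = ⊤ :=
    top_le_iff.1 (hβ ▸ Submodule.span_le.2 hτspan)
  obtain ⟨σ, rfl⟩ : ∃ σ : Finset (Fin n), τ = (σ : Set (Fin n)) := ⟨τ.toFinset, by simp⟩
  have hσ : LinearIndependent ℝ (fun j : σ => realCol A j) := hτ
  suffices ∀ i, ∃ z : ℤ, y i = z by
    choose y' hy' using this
    exact ⟨y', funext hy'⟩
  intro i
  have hi : (Pi.single i 1 : Fin d → ℝ) ∈ Submodule.span ℝ (realCol A '' σ) := htop ▸ trivial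
  obtain ⟨c, hc⟩ := (Submodule.mem_span_image_finset_iff_exists_fun' ℝ).1 hi
  obtain ⟨N, hN⟩ : ∃ N : ℕ, ∀ j, -c j ≤ N := by
    obtain ⟨N, hN⟩ := exists_nat_ge (∑ j, |c j|)
    exact ⟨N, fun j => ((neg_le_abs _).trans
      (Finset.single_le_sum (fun j _ => abs_nonneg (c j)) (Finset.mem_univ j))).trans hN⟩
  -- adding a large multiple of `∑ a_j` makes the coefficients nonnegative: they are a vertex
  let x : Fin n → ℝ := fun j => if j ∈ σ then c j + N else 0
  let b : Fin d → ℤ := Pi.single i 1 + (N : ℤ) • ∑ j ∈ σ, A.col j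
  have hx : x ∈ fiberPolyhedron A b := by
    refine ⟨?_, fun j => ?_⟩
    · rw [mulVec_map_cast_eq_sum]
      have : ∑ j, x j • realCol A j = ∑ j ∈ σ, (c j • realCol A j + (N : ℝ) • realCol A j) := by
        rw [← Finset.sum_subset (Finset.subset_univ σ) (fun j _ hj => by simp [x, hj])]
        exact Finset.sum_congr rfl fun j hj => by simp [x, hj, add_smul]
      rw [this, Finset.sum_add_distrib, hc, ← Finset.smul_sum]
      ext l
      simp [b, realCol, Finset.sum_apply, Pi.single_apply]
    · by_cases hj : j ∈ σ
      · have := hN j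
        simp only [x, hj, if_true, Pi.zero_apply]
        linarith
      · simp [x, hj]
  have hint := hA b (hspan ▸ trivial) x
    (mem_extremePoints_fiberPolyhedron hσ hx (fun j hj => by simp [x, hj]))
  have hcint : ∀ j ∈ σ, ∃ z : ℤ, c j = z := by
    intro j hj
    obtain ⟨z, hz⟩ := hint j
    refine ⟨z - N, ?_⟩
    simp only [x, hj, if_true] at hz
    push_cast
    linarith
  have hyi : y i = ∑ j ∈ σ, c j * dotProduct y (realCol A j) := by
    have : y i = dotProduct y (Pi.single i 1) := by simp
    rw [this, ← hc]
    simp [dotProduct_sum]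
  rw [hyi]
  have : ∀ s ⊆ σ, ∃ z : ℤ, ∑ j ∈ s, c j * dotProduct y (realCol A j) = z := by
    intro s
    induction s using Finset.induction_on with
    | empty => exact fun _ => ⟨0, by simp⟩
    | insert a s ha ih =>
      intro hs
      obtain ⟨z, hz⟩ := ih ((Finset.subset_insert a s).trans hs)
      obtain ⟨z₁, h₁⟩ := hcint a (hs (Finset.mem_insert_self a s))
      obtain ⟨z₂, h₂⟩ := hy a (hτβ (hs (Finset.mem_insert_self a s)))
      exact ⟨z₁ * z₂ + z, by rw [Finset.sum_insert ha, hz, h₁, h₂]; push_cast; ring⟩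
  exact this σ subset_rfl

theorem eq_zero_of_forall_dotProduct_realCol {A : Matrix (Fin d) (Fin n) ℤ}
    (hspan : Submodule.span ℤ (Set.range A.col) = ⊤) {y : Fin d → ℝ}
    (hy : ∀ j, dotProduct y (realCol A j) = 0) : y = 0 := by
  have key : ∀ v ∈ Submodule.span ℤ (Set.range A.col),
      dotProduct y (fun i => (v i : ℝ)) = 0 := by
    intro v hv
    induction hv using Submodule.span_induction with
    | mem v hv =>
      obtain ⟨j, rfl⟩ := hv
      exact hy j
    | zero => simp [dotProduct]
    | add v w _ _ hv hw =>
      simp only [dotProduct, Pi.add_apply, Int.cast_add, mul_add, Finset.sum_add_distrib] at *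
      rw [hv, hw, add_zero]
    | smul t v _ hv =>
      simp only [dotProduct, Pi.smul_apply, smul_eq_mul, Int.cast_mul] at *
      simp only [mul_left_comm (y _)]
      rw [← Finset.mul_sum, hv, mul_zero]
  ext i
  have h := key (Pi.single i 1) (hspan ▸ trivial)
  have : (fun l => ((Pi.single i 1 : Fin d → ℤ) l : ℝ)) = Pi.single i 1 := by
    ext l; by_cases h : l = i
    · subst h; simp
    · simp [h]
  rw [this] at h
  simpa using h

/-- Integral Farkas lemma for unimodular matrices: a point outside a cone of columns is separated
from it by an integral vector that pairs to at least `-1` with all other columns. Such a vector is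
found at a vertex of the polytope of all separating vectors with pairings at most `1` in absolute
value; there the pairings with a spanning set of columns are `-1`, `0` or `1`. -/
theorem exists_int_separating {A : Matrix (Fin d) (Fin n) ℤ} (hA : IsUnimodular A)
    (hspan : Submodule.span ℤ (Set.range A.col) = ⊤) {σ : Finset (Fin n)} {b : Fin d → ℝ}
    (hb : b ∉ colCone A σ) :
    ∃ y : Fin d → ℤ, (∀ j ∈ σ, 0 ≤ Matrix.vecMul y A j) ∧ (∀ j, -1 ≤ Matrix.vecMul y A j) ∧
      dotProduct (fun i => (y i : ℝ)) b < 0 := by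
  classical
  let g : (Fin d → ℝ) →ₗ[ℝ] (Fin n → ℝ) := (A.map (Int.cast : ℤ → ℝ)).vecMulLinear
  have hg : ∀ y j, g y j = dotProduct y (realCol A j) := fun y j => rfl
  have hginj : LinearMap.ker g = ⊥ := by
    refine LinearMap.ker_eq_bot'.2 fun y hy =>
      eq_zero_of_forall_dotProduct_realCol hspan fun j => ?_
    rw [← hg, hy, Pi.zero_apply]
  let lo : Fin n → ℝ := fun j => if j ∈ σ then 0 else -1
  have hlo : ∀ j, lo j ≤ 0 := fun j => by dsimp only [lo]; split_ifs <;> norm_num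
  let Q : Set (Fin d → ℝ) := g ⁻¹' Set.Icc lo 1
  have hQ : ∀ y, y ∈ Q ↔ ∀ j, lo j ≤ g y j ∧ g y j ≤ 1 := fun y =>
    ⟨fun h j => ⟨h.1 j, h.2 j⟩, fun h => ⟨fun j => (h j).1, fun j => (h j).2⟩⟩
  have hQc : IsCompact Q :=
    (LinearMap.isClosedEmbedding_of_injective hginj).isCompact_preimage isCompact_Icc
  have hφc : Continuous fun y : Fin d → ℝ => dotProduct y b := by
    unfold dotProduct; fun_prop
  obtain ⟨y₁, hy₁Q, hy₁⟩ : ∃ y ∈ Q, dotProduct y b < 0 := by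
    rw [colCone_eq_finCone] at hb
    obtain ⟨f, hf, hfb⟩ := exists_separating_of_notMem_finCone hb
    obtain ⟨z, hz⟩ := exists_forall_eq_dotProduct f.toLinearMap
    have hz : ∀ v, f v = dotProduct z v := hz
    have hM : ∀ j, |g z j| < 1 + ∑ j, |g z j| := fun j => by
      have := Finset.single_le_sum (fun j _ => abs_nonneg (g z j)) (Finset.mem_univ j)
      linarith
    have hMpos : 0 < 1 + ∑ j, |g z j| := by positivity
    refine ⟨(1 + ∑ j, |g z j|)⁻¹ • z, (hQ _).2 fun j => ?_, ?_⟩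
    · have h1 := abs_lt.1 (hM j)
      rw [map_smul, Pi.smul_apply, smul_eq_mul]
      refine ⟨?_, by rw [inv_mul_le_iff₀ hMpos]; linarith⟩
      by_cases hj : j ∈ σ
      · simp only [lo, hj, if_true]
        exact mul_nonneg (inv_nonneg.2 hMpos.le) (by rw [hg, ← hz]; exact hf j hj)
      · simp only [lo, hj, if_false]
        rw [le_inv_mul_iff₀ hMpos]; linarith
    · rw [smul_dotProduct, smul_eq_mul, ← hz]
      exact mul_neg_of_pos_of_neg (inv_pos.2 hMpos) hfb
  obtain ⟨y₀, hy₀Q, hmin⟩ := hQc.exists_isMinOn ⟨y₁, hy₁Q⟩ hφc.continuousOn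
  have hmin : ∀ y ∈ Q, dotProduct y₀ b ≤ dotProduct y b := fun y hy => hmin hy
  have hneg : dotProduct y₀ b < 0 := (hmin y₁ hy₁Q).trans_lt hy₁
  let F : Set (Fin d → ℝ) := Q ∩ {y | dotProduct y b = dotProduct y₀ b}
  have hFc : IsCompact F := hQc.inter_right (isClosed_eq hφc continuous_const)
  obtain ⟨y, hyF, hyext⟩ := hFc.extremePoints_nonempty ⟨y₀, hy₀Q, rfl⟩
  have hyQ := (hQ y).1 hyF.1
  have hyb : dotProduct y b = dotProduct y₀ b := hyF.2
  let β : Set (Fin n) := {j | g y j = lo j ∨ g y j = 1}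
  have hβ : Submodule.span ℝ (realCol A '' β) = ⊤ := by
    by_contra hne
    obtain ⟨f, hfne, hf⟩ := Submodule.exists_le_ker_of_lt_top _ (lt_top_iff_ne_top.2 hne)
    obtain ⟨z, hz⟩ := exists_forall_eq_dotProduct f
    have hz0 : z ≠ 0 := by
      rintro rfl
      exact hfne (LinearMap.ext fun v => by simp [hz])
    have hgz : ∀ j ∈ β, g z j = 0 := fun j hj => by
      rw [hg, ← hz]
      exact hf (Submodule.subset_span ⟨j, hj, rfl⟩)
    have hev : ∀ᶠ ε in nhds (0 : ℝ), y + ε • z ∈ Q := by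
      simp only [hQ]
      refine Filter.eventually_all.2 fun j => ?_
      have hlin : ∀ ε : ℝ, g (y + ε • z) j = g y j + ε * g z j := fun ε => by simp
      simp only [hlin]
      by_cases hj : j ∈ β
      · simp only [hgz j hj, mul_zero, add_zero]
        exact Filter.Eventually.of_forall fun _ => hyQ j
      · have h1 : lo j < g y j := lt_of_le_of_ne (hyQ j).1 fun h => hj (Or.inl h.symm)
        have h2 : g y j < 1 := lt_of_le_of_ne (hyQ j).2 fun h => hj (Or.inr h)
        have hc : Filter.Tendsto (fun ε : ℝ => g y j + ε * g z j) (nhds 0) (nhds (g y j)) := by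
          have hc : Continuous fun ε : ℝ => g y j + ε * g z j := by fun_prop
          simpa using hc.tendsto 0
        filter_upwards [hc.eventually (lt_mem_nhds h1), hc.eventually (gt_mem_nhds h2)]
          with ε h3 h4 using ⟨h3.le, h4.le⟩
    have hev' : ∀ᶠ ε in nhds (0 : ℝ), y + (-ε) • z ∈ Q := by
      have : Filter.Tendsto (fun ε : ℝ => -ε) (nhds 0) (nhds 0) := by
        simpa using (continuous_neg (G := ℝ)).tendsto 0
      exact this.eventually hev
    obtain ⟨ε, ⟨h1, h2⟩, hε⟩ := (((hev.and hev').filter_mono nhdsWithin_le_nhds).and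
      (self_mem_nhdsWithin : Set.Ioi (0 : ℝ) ∈ nhdsWithin 0 (Set.Ioi 0))).exists
    have hε : 0 < ε := hε
    have e1 := hmin _ h1
    have e2 := hmin _ h2
    simp only [add_dotProduct, smul_dotProduct, smul_eq_mul, hyb] at e1 e2
    have e3 : ε * dotProduct z b = 0 := by linarith
    have := hyext (x₁ := y + ε • z) ⟨h1, by simp [add_dotProduct, smul_dotProduct, hyb, e3]⟩
      (x₂ := y + (-ε) • z) ⟨h2, by simp [add_dotProduct, smul_dotProduct, hyb, e3]⟩
      ⟨1 / 2, 1 / 2, by norm_num, by norm_num, by norm_num, by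
        ext i; simp; ring⟩
    exact (smul_ne_zero hε.ne' hz0) (by simpa using this)
  obtain ⟨y', rfl⟩ := exists_eq_intCast_of_span_eq_top hA hspan hβ (y := y) fun j hj => by
    rw [← hg]
    rcases hj with h | h
    · by_cases hjσ : j ∈ σ
      · exact ⟨0, by simp [h, lo, hjσ]⟩
      · exact ⟨-1, by simp [h, lo, hjσ]⟩
    · exact ⟨1, by simp [h]⟩
  have hlow : ∀ j, lo j ≤ ((Matrix.vecMul y' A j : ℤ) : ℝ) := fun j => by
    rw [← dotProduct_intCast_realCol, ← hg]; exact (hyQ j).1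
  refine ⟨y', fun j hj => ?_, fun j => ?_, hyb ▸ hneg⟩
  · have := hlow j
    simp only [lo, hj, if_true] at this
    exact_mod_cast this
  · have h1 : (-1 : ℝ) ≤ lo j := by dsimp only [lo]; split_ifs <;> norm_num
    exact_mod_cast h1.trans (hlow j)

/-- The exponent `u` minimizes the linear form induced by `b` on its fiber: no lattice vector
`yᵀA` that keeps `u + yᵀA` nonnegative has a negative value `y ⬝ b`. -/
def IsFiberMin (A : Matrix (Fin d) (Fin n) ℤ) (b : Fin d → ℝ) (u : Fin n →₀ ℕ) : Prop :=
  ∀ y : Fin d → ℤ, (∀ j, 0 ≤ (u j : ℤ) + Matrix.vecMul y A j) →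
    0 ≤ dotProduct (fun i => (y i : ℝ)) b

/-- Integer programming duality over a unimodular matrix: `u` is optimal exactly when `b` lies in
the cone of the columns at which `u` vanishes. -/
theorem isFiberMin_iff_mem_colCone {A : Matrix (Fin d) (Fin n) ℤ} (hA : IsUnimodular A)
    (hspan : Submodule.span ℤ (Set.range A.col) = ⊤) {b : Fin d → ℝ} {u : Fin n →₀ ℕ} :
    IsFiberMin A b u ↔ b ∈ colCone A u.supportᶜ := by
  constructor
  · intro h
    by_contra hb
    obtain ⟨y, h1, h2, h3⟩ := exists_int_separating hA hspan hb
    refine not_le.2 h3 (h y fun j => ?_)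
    by_cases hj : u j = 0
    · have := h1 j (by simp [hj])
      omega
    · have := h2 j
      omega
  · intro hb y hy
    rw [colCone_eq_finCone] at hb
    obtain ⟨x, hx, hx0, rfl⟩ := hb
    rw [dotProduct_sum_smul_realCol]
    refine Finset.sum_nonneg fun j _ => ?_
    by_cases hj : u j = 0
    · refine mul_nonneg (hx j) ?_
      have := hy j
      rw [hj] at this
      rw [dotProduct_intCast_realCol]
      exact_mod_cast (by simpa using this)
    · rw [hx0 j (by simpa using hj), zero_mul]

/-- Every set of columns is the zero set of an exponent, so the optimal exponents record the cones
containing `b`. -/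
theorem forall_isFiberMin_iff_sameCones {A : Matrix (Fin d) (Fin n) ℤ} (hA : IsUnimodular A)
    (hspan : Submodule.span ℤ (Set.range A.col) = ⊤) {b b' : Fin d → ℝ} :
    (∀ u, IsFiberMin A b u ↔ IsFiberMin A b' u) ↔ SameCones A b b' := by
  classical
  simp only [isFiberMin_iff_mem_colCone hA hspan, sameCones_iff_forall]
  refine ⟨fun h σ => ?_, fun h u => h _⟩
  have := h (Finsupp.equivFunOnFinite.symm fun j => if j ∈ σ then 0 else 1)
  have hs : (Finsupp.equivFunOnFinite.symm fun j => if j ∈ σ then (0 : ℕ) else 1).supportᶜ = σ := by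
    ext j; simp
  rwa [hs] at this

end Unimodular

/-! ### Initial ideals of the row ideal -/

section InitialIdeals

variable {k : Type*} [Field k] {d n : ℕ}

theorem IsFiberMin.of_add {A : Matrix (Fin d) (Fin n) ℤ} {b : Fin d → ℝ} {c u : Fin n →₀ ℕ}
    (h : IsFiberMin A b (c + u)) : IsFiberMin A b u := by
  intro y hy
  refine h y fun j => ?_
  have := hy j
  simp only [Finsupp.add_apply]
  push_cast
  omega

theorem IsFiberMin.of_dotProduct_eq_zero {A : Matrix (Fin d) (Fin n) ℤ} {b : Fin d → ℝ}
    {u v : Fin n →₀ ℕ} (h : IsFiberMin A b u) {y : Fin d → ℤ}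
    (hv : ∀ j, (v j : ℤ) = u j + Matrix.vecMul y A j)
    (hy : dotProduct (fun i => (y i : ℝ)) b = 0) : IsFiberMin A b v := by
  intro z hz
  have h1 := h (y + z) fun j => by
    have := hz j
    rw [Matrix.add_vecMul, Pi.add_apply, ← add_assoc, ← hv]
    exact this
  have : (fun i => (((y + z) i : ℤ) : ℝ)) = (fun i => (y i : ℝ)) + fun i => (z i : ℝ) := by
    ext i; simp
  rwa [this, add_dotProduct, hy, zero_add] at h1

/-- The weight of an exponent changes along the row lattice by the pairing with `A w`. -/
theorem weight_eq_add_dotProduct_mulVec {A : Matrix (Fin d) (Fin n) ℤ} (w : Fin n → ℝ)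
    {u v : Fin n →₀ ℕ} {y : Fin d → ℤ} (hv : ∀ j, (v j : ℤ) = u j + Matrix.vecMul y A j) :
    Finsupp.weight w v = Finsupp.weight w u +
      dotProduct (fun i => (y i : ℝ)) ((A.map (Int.cast : ℤ → ℝ)).mulVec w) := by
  have hw : ∀ u : Fin n →₀ ℕ, Finsupp.weight w u = ∑ j, (u j : ℝ) * w j := fun u => by
    rw [Finsupp.weight_apply, Finsupp.sum_fintype _ _ (by simp)]
    simp
  rw [hw, hw, mulVec_map_cast_eq_sum, dotProduct_sum_smul_realCol, ← Finset.sum_add_distrib]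
  refine Finset.sum_congr rfl fun j _ => ?_
  have h : (v j : ℝ) = u j + ((Matrix.vecMul y A j : ℤ) : ℝ) := by exact_mod_cast hv j
  rw [h, dotProduct_intCast_realCol]
  ring

theorem toLaurent_monomial (u : Fin n →₀ ℕ) (c : k) :
    toLaurent k n (monomial u c) = AddMonoidAlgebra.single (fun j => (u j : ℤ)) c := by
  have h : ∀ s : Finset (Fin n), ∏ j ∈ s, (AddMonoidAlgebra.single (Pi.single j 1) 1 :
      AddMonoidAlgebra k (Fin n → ℤ)) ^ u j =
      AddMonoidAlgebra.single (∑ j ∈ s, u j • (Pi.single j 1 : Fin n → ℤ)) 1 := by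
    intro s
    induction s using Finset.induction_on with
    | empty => simp [AddMonoidAlgebra.one_def]
    | insert a s ha ih =>
      rw [Finset.prod_insert ha, ih, Finset.sum_insert ha, AddMonoidAlgebra.single_pow,
        AddMonoidAlgebra.single_mul_single]
      simp
  have hs : ∑ j, u j • (Pi.single j 1 : Fin n → ℤ) = fun j => (u j : ℤ) := by
    ext l
    simp [Finset.sum_apply, Pi.single_apply]
  rw [toLaurent, aeval_monomial, Finsupp.prod_fintype _ _ (by simp), h, hs]
  simp [AddMonoidAlgebra.single_mul_single]

theorem single_sub_one_mem_span_rows (A : Matrix (Fin d) (Fin n) ℤ) (y : Fin d → ℤ) :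
    (AddMonoidAlgebra.single (Matrix.vecMul y A) 1 - 1 : AddMonoidAlgebra k (Fin n → ℤ)) ∈
      Ideal.span (Set.range fun i =>
        (AddMonoidAlgebra.single (A i) 1 - 1 : AddMonoidAlgebra k (Fin n → ℤ))) := by
  set I := Ideal.span (Set.range fun i =>
        (AddMonoidAlgebra.single (A i) 1 - 1 : AddMonoidAlgebra k (Fin n → ℤ)))
  let S : AddSubgroup (Fin n → ℤ) :=
    { carrier := {z | (AddMonoidAlgebra.single z 1 - 1 : AddMonoidAlgebra k (Fin n → ℤ)) ∈ I}
      zero_mem' := by simp [AddMonoidAlgebra.one_def]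
      add_mem' := fun {z t} hz ht => by
        have := I.add_mem (I.mul_mem_left (AddMonoidAlgebra.single z 1) ht) hz
        rw [mul_sub, AddMonoidAlgebra.single_mul_single, mul_one, mul_one] at this
        simpa using this
      neg_mem' := fun {z} hz => by
        have := I.neg_mem (I.mul_mem_left (AddMonoidAlgebra.single (-z) 1) hz)
        rw [mul_sub, AddMonoidAlgebra.single_mul_single, mul_one, mul_one, neg_add_cancel] at this
        simpa [AddMonoidAlgebra.one_def] using this }
  suffices Matrix.vecMul y A ∈ S from this
  rw [Matrix.vecMul_eq_sum]
  exact S.sum_mem fun i _ => S.zsmul_mem (Ideal.subset_span ⟨i, rfl⟩ : A i ∈ S) (y i)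

theorem monomial_sub_monomial_mem_rowIdeal {A : Matrix (Fin d) (Fin n) ℤ} {u v : Fin n →₀ ℕ}
    {y : Fin d → ℤ} (hv : ∀ j, (v j : ℤ) = u j + Matrix.vecMul y A j) (c : k) :
    monomial u c - monomial v c ∈ rowIdeal k A := by
  rw [rowIdeal, Ideal.mem_comap, map_sub, toLaurent_monomial, toLaurent_monomial]
  have := Ideal.mul_mem_left _ (-AddMonoidAlgebra.single (fun j => (u j : ℤ)) c)
    (single_sub_one_mem_span_rows (k := k) A y)
  rw [neg_mul, mul_sub, AddMonoidAlgebra.single_mul_single, mul_one, mul_one, neg_sub] at this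
  have e : (fun j => (v j : ℤ)) = (fun j => (u j : ℤ)) + Matrix.vecMul y A := funext hv
  rwa [e]

/-- A binomial in `J_A` is a multiple of the difference of two monomials whose exponents differ by
an element of the row lattice: map to the group algebra of `ℤⁿ` modulo this lattice. -/
theorem exists_eq_monomial_sub_of_isBinomial {A : Matrix (Fin d) (Fin n) ℤ}
    {f : MvPolynomial (Fin n) k} (hf : f ∈ rowIdeal k A) (hbin : IsBinomial f) :
    ∃ (u v : Fin n →₀ ℕ) (c : k) (y : Fin d → ℤ), u ≠ v ∧ c ≠ 0 ∧
      (∀ j, (v j : ℤ) = u j + Matrix.vecMul y A j) ∧ f = monomial u c - monomial v c := by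
  classical
  obtain ⟨u, v, huv, hsupp⟩ := Finset.card_eq_two.1 hbin
  have hfe : f = monomial u (f.coeff u) + monomial v (f.coeff v) := by
    conv_lhs => rw [f.as_sum, hsupp, Finset.sum_pair huv]
  have hu : f.coeff u ≠ 0 := by rw [← mem_support_iff, hsupp]; simp
  let L : AddSubgroup (Fin n → ℤ) := (Submodule.span ℤ (Set.range fun i => A i)).toAddSubgroup
  let q : (Fin n → ℤ) →+ (Fin n → ℤ) ⧸ L := QuotientAddGroup.mk' L
  let ψ := AddMonoidAlgebra.mapDomainRingHom k q
  have hψ : ∀ z (c : k), ψ (AddMonoidAlgebra.single z c) = AddMonoidAlgebra.single (q z) c := by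
    intro z c
    simp [ψ]
  have hker : ψ (toLaurent k n f) = 0 := by
    have hle : Ideal.span (Set.range fun i =>
        (AddMonoidAlgebra.single (A i) 1 - 1 : AddMonoidAlgebra k (Fin n → ℤ))) ≤
        RingHom.ker ψ := by
      rw [Ideal.span_le]
      rintro _ ⟨i, rfl⟩
      have hq : q (A i) = 0 :=
        (QuotientAddGroup.eq_zero_iff _).2 (Submodule.subset_span ⟨i, rfl⟩)
      show ψ (AddMonoidAlgebra.single (A i) 1 - 1) = 0
      rw [map_sub, hψ, hq, map_one, AddMonoidAlgebra.one_def, sub_self]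
    exact hle hf
  rw [hfe, map_add, toLaurent_monomial, toLaurent_monomial, map_add, hψ, hψ] at hker
  have hquv : q (fun j => (u j : ℤ)) = q (fun j => (v j : ℤ)) := by
    by_contra hne
    have := congrArg (fun p => p.coeff (q fun j => (u j : ℤ))) hker
    simp [Ne.symm hne] at this
    exact hu this
  rw [hquv] at hker
  have hsum : f.coeff u + f.coeff v = 0 := by
    simpa using congrArg (fun p => p.coeff (q fun j => (v j : ℤ))) hker
  have hmem : -(fun j => (u j : ℤ)) + (fun j => (v j : ℤ)) ∈
      Submodule.span ℤ (Set.range fun i => A i) := QuotientAddGroup.eq.1 hquv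
  obtain ⟨y, hy⟩ := (Submodule.mem_span_range_iff_exists_fun ℤ).1 hmem
  refine ⟨u, v, f.coeff u, y, huv, hu, fun j => ?_, ?_⟩
  · have := congrFun hy j
    rw [Matrix.vecMul_eq_sum, this]
    simp
  · rw [sub_eq_add_neg, ← map_neg, ← eq_neg_of_add_eq_zero_right hsum]
    exact hfe

theorem support_monomial_sub_monomial {u v : Fin n →₀ ℕ} (huv : u ≠ v) {c : k} (hc : c ≠ 0) :
    (monomial u c - monomial v c).support = {u, v} := by
  classical
  ext a
  rw [mem_support_iff, coeff_sub, coeff_monomial, coeff_monomial, Finset.mem_insert,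
    Finset.mem_singleton]
  by_cases h1 : u = a
  · subst h1; simp [huv.symm, hc]
  · by_cases h2 : v = a
    · subst h2; simp [h1, hc]
    · simp [h1, h2, Ne.symm h1, Ne.symm h2]

theorem isBinomial_monomial_sub_monomial {u v : Fin n →₀ ℕ} (huv : u ≠ v) {c : k} (hc : c ≠ 0) :
    IsBinomial (monomial u c - monomial v c) := by
  classical
  rw [IsBinomial, support_monomial_sub_monomial huv hc, Finset.card_pair huv]

theorem initialForm_monomial_sub_of_lt {w : Fin n → ℝ} {u v : Fin n →₀ ℕ} {c : k} (hc : c ≠ 0)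
    (h : Finsupp.weight w v < Finsupp.weight w u) :
    initialForm w (monomial u c - monomial v c) = monomial u c := by
  classical
  have huv : u ≠ v := by rintro rfl; exact lt_irrefl _ h
  have hfilter : ({u, v} : Finset (Fin n →₀ ℕ)).filter
      (fun a => ∀ b ∈ ({u, v} : Finset (Fin n →₀ ℕ)), Finsupp.weight w b ≤ Finsupp.weight w a) =
      {u} := by
    ext a
    simp only [Finset.mem_filter, Finset.mem_insert, Finset.mem_singleton, forall_eq_or_imp,
      forall_eq]
    constructor
    · rintro ⟨rfl | rfl, h1, -⟩
      · rfl
      · exact absurd h1 (not_le.2 h)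
    · rintro rfl
      exact ⟨Or.inl rfl, le_rfl, h.le⟩
  rw [initialForm, support_monomial_sub_monomial huv hc]
  convert Finset.sum_singleton _ u using 2
  simp [coeff_monomial, huv.symm]

theorem initialForm_monomial_sub_of_eq {w : Fin n → ℝ} {u v : Fin n →₀ ℕ} (huv : u ≠ v) {c : k}
    (hc : c ≠ 0) (h : Finsupp.weight w v = Finsupp.weight w u) :
    initialForm w (monomial u c - monomial v c) = monomial u c - monomial v c := by
  classical
  conv_rhs => rw [(monomial u c - monomial v c).as_sum]
  rw [initialForm, Finset.filter_true_of_mem]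
  rw [support_monomial_sub_monomial huv hc]
  intro a ha b hb
  simp only [Finset.mem_insert, Finset.mem_singleton] at ha hb
  rcases ha with rfl | rfl <;> rcases hb with rfl | rfl <;> simp [h]

/-- The shape of the generators of the initial ideal of `J_A`: monomials with a lattice neighbor of
smaller weight, and differences of monomials of equal weight. -/
theorem initialForm_cases {A : Matrix (Fin d) (Fin n) ℤ} (w : Fin n → ℝ)
    {f : MvPolynomial (Fin n) k} (hf : f ∈ rowIdeal k A) (hbin : IsBinomial f) :
    (∃ (u : Fin n →₀ ℕ) (c : k), initialForm w f = monomial u c ∧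
      ¬ IsFiberMin A ((A.map (Int.cast : ℤ → ℝ)).mulVec w) u) ∨
    ∃ (u v : Fin n →₀ ℕ) (c : k) (y : Fin d → ℤ), u ≠ v ∧ c ≠ 0 ∧
      (∀ j, (v j : ℤ) = u j + Matrix.vecMul y A j) ∧
      dotProduct (fun i => (y i : ℝ)) ((A.map (Int.cast : ℤ → ℝ)).mulVec w) = 0 ∧
      initialForm w f = monomial u c - monomial v c := by
  have key : ∀ (u v : Fin n →₀ ℕ) (c : k) (y : Fin d → ℤ), c ≠ 0 →
      (∀ j, (v j : ℤ) = u j + Matrix.vecMul y A j) → f = monomial u c - monomial v c →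
      Finsupp.weight w v < Finsupp.weight w u → ∃ (u : Fin n →₀ ℕ) (c : k),
        initialForm w f = monomial u c ∧
          ¬ IsFiberMin A ((A.map (Int.cast : ℤ → ℝ)).mulVec w) u := by
    intro u v c y hc hv hfe hlt
    refine ⟨u, c, hfe ▸ initialForm_monomial_sub_of_lt hc hlt, fun hmin => ?_⟩
    have h1 := hmin y fun j => by rw [← hv]; positivity
    rw [weight_eq_add_dotProduct_mulVec w hv] at hlt
    linarith
  obtain ⟨u, v, c, y, huv, hc, hv, hfe⟩ := exists_eq_monomial_sub_of_isBinomial hf hbin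
  rcases lt_trichotomy (Finsupp.weight w v) (Finsupp.weight w u) with h | h | h
  · exact Or.inl (key u v c y hc hv hfe h)
  · refine Or.inr ⟨u, v, c, y, huv, hc, hv, ?_, ?_⟩
    · rw [weight_eq_add_dotProduct_mulVec w hv] at h
      linarith
    · rw [hfe]; exact initialForm_monomial_sub_of_eq huv hc h
  · refine Or.inl (key v u (-c) (-y) (neg_ne_zero.2 hc) (fun j => ?_) ?_ h)
    · rw [Matrix.neg_vecMul, Pi.neg_apply, hv j]; ring
    · rw [hfe, map_neg, map_neg]; ring

/-- Sums of coefficients over the optimal monomials of one fiber vanish on the initial ideal, so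
the monomials in it are exactly those that are not optimal. -/
theorem monomial_mem_initialIdeal_iff {A : Matrix (Fin d) (Fin n) ℤ} (w : Fin n → ℝ)
    (u : Fin n →₀ ℕ) : monomial u (1 : k) ∈ initialIdeal (rowIdeal k A) w ↔
      ¬ IsFiberMin A ((A.map (Int.cast : ℤ → ℝ)).mulVec w) u := by
  classical
  set b := (A.map (Int.cast : ℤ → ℝ)).mulVec w with hb
  constructor
  · intro hu hmin
    let S : (Fin n →₀ ℕ) → Prop := fun v => ∃ y : Fin d → ℤ,
      (∀ j, (v j : ℤ) = u j + Matrix.vecMul y A j) ∧ dotProduct (fun i => (y i : ℝ)) b = 0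
    have hSmin : ∀ v, S v → IsFiberMin A b v := fun v ⟨y, h1, h2⟩ =>
      hmin.of_dotProduct_eq_zero h1 h2
    let l : MvPolynomial (Fin n) k →ₗ[k] k :=
      (basisMonomials (Fin n) k).constr k fun v => if S v then 1 else 0
    have hl : ∀ v (c : k), l (monomial v c) = if S v then c else 0 := by
      intro v c
      have h1 : l (monomial v 1) = if S v then 1 else 0 := by
        have := (basisMonomials (Fin n) k).constr_basis k (fun v => if S v then (1 : k) else 0) v
        rwa [coe_basisMonomials] at this
      have h2 : monomial v c = c • monomial v (1 : k) := by simp [smul_monomial]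
      rw [h2, map_smul, h1]
      simp
    have hcast : ∀ y z : Fin d → ℤ, (fun i => (((y + z) i : ℤ) : ℝ)) =
        (fun i => (y i : ℝ)) + fun i => (z i : ℝ) := fun y z => by
      ext i; simp
    have hvanish : ∀ g ∈ initialIdeal (rowIdeal k A) w, ∀ p, l (p * g) = 0 := by
      intro g hg
      induction hg using Submodule.span_induction with
      | mem g hg =>
        obtain ⟨f, ⟨hf, hbin⟩, rfl⟩ := hg
        intro p
        induction p using MvPolynomial.induction_on' with
        | add p q hp hq => rw [add_mul, map_add, hp, hq, add_zero]
        | monomial a s =>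
          rcases initialForm_cases w hf hbin with ⟨v, c, he, hv⟩ | ⟨v, v', c, y, -, -, hv, hy, he⟩
          · rw [he, monomial_mul, hl, if_neg]
            exact fun hS => hv (hSmin _ hS).of_add
          · have hiff : S (a + v) ↔ S (a + v') := by
              constructor
              · rintro ⟨z, h1, h2⟩
                refine ⟨z + y, fun j => ?_, ?_⟩
                · have := h1 j
                  have := hv j
                  simp only [Finsupp.add_apply, Matrix.add_vecMul, Pi.add_apply] at *
                  push_cast at *
                  linarith
                · rw [hcast z y, add_dotProduct, h2, hy, add_zero]
              · rintro ⟨z, h1, h2⟩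
                refine ⟨z - y, fun j => ?_, ?_⟩
                · have := h1 j
                  have := hv j
                  simp only [Finsupp.add_apply, Matrix.sub_vecMul, Pi.sub_apply] at *
                  push_cast at *
                  linarith
                · have := hcast (z - y) y
                  rw [sub_add_cancel] at this
                  rw [this, add_dotProduct, hy, add_zero] at h2
                  exact h2
            rw [he, mul_sub, monomial_mul, monomial_mul, map_sub, hl, hl]
            simp [hiff]
      | zero => simp
      | add g h _ _ hg hh => intro p; rw [mul_add, map_add, hg, hh, add_zero]
      | smul a g _ hg => intro p; rw [smul_eq_mul, ← mul_assoc, hg]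
    have h1 := hvanish _ hu 1
    rw [one_mul, hl, if_pos ⟨0, by simp, by simp [dotProduct]⟩] at h1
    exact one_ne_zero h1
  · intro h
    simp only [IsFiberMin, not_forall, not_le] at h
    obtain ⟨y, hy, hneg⟩ := h
    let v : Fin n →₀ ℕ := Finsupp.equivFunOnFinite.symm fun j =>
      ((u j : ℤ) + Matrix.vecMul y A j).toNat
    have hv : ∀ j, (v j : ℤ) = u j + Matrix.vecMul y A j := fun j => by
      simp [v, hy j]
    have hlt : Finsupp.weight w v < Finsupp.weight w u := by
      rw [weight_eq_add_dotProduct_mulVec w hv]; linarith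
    refine Ideal.subset_span ⟨monomial u 1 - monomial v 1,
      ⟨monomial_sub_monomial_mem_rowIdeal hv 1, isBinomial_monomial_sub_monomial ?_ one_ne_zero⟩,
      initialForm_monomial_sub_of_lt one_ne_zero hlt⟩
    rintro h
    rw [h] at hlt
    exact lt_irrefl _ hlt

theorem initialIdeal_le_of_forall_isFiberMin_iff {A : Matrix (Fin d) (Fin n) ℤ} {w w' : Fin n → ℝ}
    (h : ∀ u, IsFiberMin A ((A.map (Int.cast : ℤ → ℝ)).mulVec w) u ↔
      IsFiberMin A ((A.map (Int.cast : ℤ → ℝ)).mulVec w') u) :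
    initialIdeal (rowIdeal k A) w ≤ initialIdeal (rowIdeal k A) w' := by
  have hmon : ∀ (u : Fin n →₀ ℕ) (c : k), ¬ IsFiberMin A ((A.map (Int.cast : ℤ → ℝ)).mulVec w) u →
      monomial u c ∈ initialIdeal (rowIdeal k A) w' := by
    intro u c hu
    have := Ideal.mul_mem_left _ (C c) ((monomial_mem_initialIdeal_iff (k := k) w' u).2
      (fun h' => hu ((h u).2 h')))
    rwa [C_mul_monomial, mul_one] at this
  refine Ideal.span_le.2 ?_
  rintro _ ⟨f, ⟨hf, hbin⟩, rfl⟩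
  rcases initialForm_cases w hf hbin with ⟨u, c, he, hu⟩ | ⟨u, v, c, y, huv, hc, hv, hy, he⟩
  · rw [he]
    exact hmon u c hu
  · rw [he]
    have hv' : ∀ j, (u j : ℤ) = v j + Matrix.vecMul (-y) A j := fun j => by
      rw [Matrix.neg_vecMul, Pi.neg_apply, hv j]; ring
    have hneg : ∀ b, dotProduct (fun i => ((-y) i : ℤ) : Fin d → ℝ) b =
        - dotProduct (fun i => (y i : ℝ)) b := fun b => by simp [dotProduct]
    by_cases hu : IsFiberMin A ((A.map (Int.cast : ℤ → ℝ)).mulVec w) u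
    · -- both monomials are optimal for `w`, hence for `w'`, so they have the same `w'`-weight
      have hvmin := hu.of_dotProduct_eq_zero hv hy
      have h1 := (h u).1 hu y fun j => by rw [← hv]; positivity
      have h2 := (h v).1 hvmin (-y) fun j => by rw [← hv']; positivity
      rw [hneg] at h2
      refine Ideal.subset_span ⟨_, ⟨monomial_sub_monomial_mem_rowIdeal hv c,
        isBinomial_monomial_sub_monomial huv hc⟩, initialForm_monomial_sub_of_eq huv hc ?_⟩
      rw [weight_eq_add_dotProduct_mulVec w' hv]
      linarith
    · refine Ideal.sub_mem _ (hmon u c hu) (hmon v c fun hvmin => hu ?_)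
      exact hvmin.of_dotProduct_eq_zero hv' (by rw [hneg, hy, neg_zero])

/-- The initial ideal of `J_A` is determined by the monomials it contains. -/
theorem initialIdeal_eq_iff {A : Matrix (Fin d) (Fin n) ℤ} {w w' : Fin n → ℝ} :
    initialIdeal (rowIdeal k A) w = initialIdeal (rowIdeal k A) w' ↔
      ∀ u, IsFiberMin A ((A.map (Int.cast : ℤ → ℝ)).mulVec w) u ↔
        IsFiberMin A ((A.map (Int.cast : ℤ → ℝ)).mulVec w') u := by
  refine ⟨fun h u => not_iff_not.1 ?_, fun h => le_antisymm
    (initialIdeal_le_of_forall_isFiberMin_iff h)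
    (initialIdeal_le_of_forall_isFiberMin_iff fun u => (h u).symm)⟩
  rw [← monomial_mem_initialIdeal_iff (k := k), ← monomial_mem_initialIdeal_iff (k := k), h]

end InitialIdeals

/-! ### The Gröbner fan -/

section GroebnerFan

variable {k : Type*} [Field k] {d n : ℕ}

theorem mem_colCone_univ_iff (A : Matrix (Fin d) (Fin n) ℤ) (b : Fin d → ℝ) :
    b ∈ colCone A Finset.univ ↔
      ∃ w : Fin n → ℝ, 0 ≤ w ∧ (A.map (Int.cast : ℤ → ℝ)).mulVec w = b := by
  rw [colCone_eq_finCone]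
  constructor
  · rintro ⟨x, hx, -, h⟩
    exact ⟨x, hx, by rw [mulVec_map_cast_eq_sum, h]⟩
  · rintro ⟨x, hx, h⟩
    exact ⟨x, hx, by simp, by rw [← h, mulVec_map_cast_eq_sum]⟩

theorem initialIdeal_eq_iff_sameCones {A : Matrix (Fin d) (Fin n) ℤ} (hA : IsUnimodular A)
    (hspan : Submodule.span ℤ (Set.range A.col) = ⊤) (w w' : Fin n → ℝ) :
    initialIdeal (rowIdeal k A) w = initialIdeal (rowIdeal k A) w' ↔
      SameCones A ((A.map (Int.cast : ℤ → ℝ)).mulVec w)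
        ((A.map (Int.cast : ℤ → ℝ)).mulVec w') :=
  initialIdeal_eq_iff.trans (forall_isFiberMin_iff_sameCones hA hspan)

/-- The Gröbner region is the preimage of the cone of `A`, since the initial ideal of `w` depends
only on `A w`. -/
theorem mem_groebnerRegion_rowIdeal_iff {A : Matrix (Fin d) (Fin n) ℤ} (hA : IsUnimodular A)
    (hspan : Submodule.span ℤ (Set.range A.col) = ⊤) (w : Fin n → ℝ) :
    w ∈ groebnerRegion (rowIdeal k A) ↔
      (A.map (Int.cast : ℤ → ℝ)).mulVec w ∈ colCone A Finset.univ := by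
  constructor
  · rintro ⟨w', hw', h⟩
    rw [initialIdeal_eq_iff_sameCones hA hspan, sameCones_iff_forall] at h
    exact (h _).1 ((mem_colCone_univ_iff A _).2 ⟨w', hw', rfl⟩)
  · intro h
    obtain ⟨w', hw', he⟩ := (mem_colCone_univ_iff A _).1 h
    refine ⟨w', hw', (initialIdeal_eq_iff_sameCones hA hspan _ _).2 ?_⟩
    rw [he]
    exact fun _ _ => Iff.rfl

theorem closure_initialIdeal_class {A : Matrix (Fin d) (Fin n) ℤ} (hA : IsUnimodular A)
    (hspan : Submodule.span ℤ (Set.range A.col) = ⊤) {w : Fin n → ℝ}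
    (hw : (A.map (Int.cast : ℤ → ℝ)).mulVec w ∈ colCone A Finset.univ) :
    closure {w' | initialIdeal (rowIdeal k A) w' = initialIdeal (rowIdeal k A) w} =
      (fun w : Fin n → ℝ => (A.map (Int.cast : ℤ → ℝ)).mulVec w) ⁻¹'
        chamber A ((A.map (Int.cast : ℤ → ℝ)).mulVec w) := by
  have := closure_sameCones_preimage A
    (LinearMap.toContinuousLinearMap (A.map (Int.cast : ℤ → ℝ)).mulVecLin) (w := w) hw
  refine Eq.trans (congrArg closure ?_) this
  ext w'
  exact eq_comm.trans (initialIdeal_eq_iff_sameCones hA hspan w w')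

theorem groebnerFan_rowIdeal_eq {A : Matrix (Fin d) (Fin n) ℤ} (hA : IsUnimodular A)
    (hspan : Submodule.span ℤ (Set.range A.col) = ⊤) :
    groebnerFan (rowIdeal k A) =
      (fun C => (fun w : Fin n → ℝ => (A.map (Int.cast : ℤ → ℝ)).mulVec w) ⁻¹' C) ''
        chamberComplex A := by
  rw [chamberComplex_eq_image_chamber]
  apply Set.Subset.antisymm
  · rintro _ ⟨w, hw, rfl⟩
    have hw' := (mem_groebnerRegion_rowIdeal_iff hA hspan w).1 hw
    exact ⟨_, ⟨_, hw', rfl⟩, (closure_initialIdeal_class hA hspan hw').symm⟩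
  · rintro _ ⟨_, ⟨b, hb, rfl⟩, rfl⟩
    obtain ⟨w, -, rfl⟩ := (mem_colCone_univ_iff A b).1 hb
    exact ⟨w, (mem_groebnerRegion_rowIdeal_iff hA hspan w).2 hb,
      (closure_initialIdeal_class hA hspan hb).symm⟩

end GroebnerFan

theorem mainTheorem4 (k : Type*) [Field k] [CharZero k] (d n : ℕ)
    (A : Matrix (Fin d) (Fin n) ℤ)
    (hA : IsUnimodular A)
    (hspan : Submodule.span ℤ (Set.range A.col) = ⊤)
    (hker : ∀ x : Fin n → ℝ, 0 ≤ x → (A.map (Int.cast : ℤ → ℝ)).mulVec x = 0 → x = 0) :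
    -- two weight vectors have the same initial ideal iff their images under `A` lie in the same
    -- (relatively open) cell of the chamber complex
    (∀ w w' : Fin n → ℝ, 0 ≤ w → 0 ≤ w' →
      (initialIdeal (rowIdeal k A) w = initialIdeal (rowIdeal k A) w' ↔
        ∃ C ∈ chamberComplex A,
          (A.map (Int.cast : ℤ → ℝ)).mulVec w ∈ intrinsicInterior ℝ C ∧
          (A.map (Int.cast : ℤ → ℝ)).mulVec w' ∈ intrinsicInterior ℝ C)) ∧
    -- equivalently, iff their images lie in the same cones spanned by independent columns
    (∀ w w' : Fin n → ℝ,
      (initialIdeal (rowIdeal k A) w = initialIdeal (rowIdeal k A) w' ↔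
        ∀ σ : Finset (Fin n), LinearIndependent ℝ (fun j : σ => realCol A j) →
          ((A.map (Int.cast : ℤ → ℝ)).mulVec w ∈ colCone A σ ↔
            (A.map (Int.cast : ℤ → ℝ)).mulVec w' ∈ colCone A σ))) ∧
    -- the Gröbner fan is the chamber complex, pulled back along `w ↦ A w`
    groebnerFan (rowIdeal k A) =
      (fun C => (fun w : Fin n → ℝ => (A.map (Int.cast : ℤ → ℝ)).mulVec w) ⁻¹' C) ''
        chamberComplex A := by
  refine ⟨fun w w' hw _ => ?_, initialIdeal_eq_iff_sameCones hA hspan,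
    groebnerFan_rowIdeal_eq hA hspan⟩
  rw [initialIdeal_eq_iff_sameCones hA hspan]
  exact sameCones_iff_exists_mem_chamberComplex ((mem_colCone_univ_iff A _).2 ⟨w, hw, rfl⟩)
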